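/- Let $k\ge 2$ and let $f=[F_0:\dots:F_k]:\mathbb P^k\dashrightarrow\mathbb P^k$ be a dominating meromorphic self-map of complex projective space, where $F_0,\dots,F_k$ are homogeneous polynomials of the same degree without nontrivial common factor whose Jacobian determinant does not vanish identically. Let $I(f)=\{F_0=\dots=F_k=0\}$ be its indeterminacy locus. For $n\ge 1$ let $f^n=f^{n-1}\circ f$ be the $n$-th iterate as a meromorphic map (common factors of the components being removed), and for an analytic set $A$ put $f^n(A)=\overline{f^n(A\setminus I(f^n))}$, $f^0(A)=A$. A hypersurface is a nonempty analytic set of pure codimension $1$. A hypersurface $\mathcal H$ is called degree lowering if $f^n(\mathcal H)\subset I(f)$ for some $n\ge 1$; the smallest such $n$ is its height. The map $f$ is algebraically stable if it has no degree lowering hypersurface. Then there are an integer $M\ge 0$ and degree lowering hypersurfaces $\mathcal H_1,\dots,\mathcal H_M$ with heights $n_1,\dots,n_M$, where every irreducible component of $\mathcal H_j$ also has height $n_j$, such that: (i) the numbers $n_1,\dots,n_M$ are pairwise different; (ii) $\operatorname{codim} f^m(\mathcal H_j)>1$ for $1\le m\le n_j$ and $1\le j\le M$; (iii) for every irreducible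 degree lowering hypersurface $\mathcal H$ of $f$, with height $h$, there are integers $0\le n<h$ and $1\le j\le M$ such that $f^n(\mathcal H)$ is a hypersurface and $f^n(\mathcal H)\subset\mathcal H_j$. The integer $M$ is unique, and the hypersurfaces $\mathcal H_j$ with their heights $n_j$ are unique up to a permutation of the indices. Moreover, $f$ is algebraically stable if and only if $M=0$. -/

import Mathlib

open MvPolynomial

noncomputable section

/-! ### Projective space with the Zariski topology -/

/-- Complex projective space `P^k`. -/
def ProjSpace (k : ℕ) : Type := Projectivization ℂ (Fin (k + 1) → ℂ)

namespace ProjSpace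

/-- The point `[v]` of `P^k` with homogeneous coordinates `v ≠ 0`. -/
def mk {k : ℕ} (v : Fin (k + 1) → ℂ) (hv : v ≠ 0) : ProjSpace k := Projectivization.mk ℂ v hv

/-- A vector of homogeneous coordinates of the point `x`. -/
def coords {k : ℕ} (x : ProjSpace k) : Fin (k + 1) → ℂ := Projectivization.rep x

theorem coords_ne_zero {k : ℕ} (x : ProjSpace k) : x.coords ≠ 0 := Projectivization.rep_nonzero x

theorem mk_coords {k : ℕ} (x : ProjSpace k) : mk x.coords x.coords_ne_zero = x :=
  Projectivization.mk_rep x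

/-- The common zero set in `P^k` of a set of polynomials. It is used only for sets of homogeneous
polynomials, for which it does not depend on the choice of homogeneous coordinates. -/
def zeroLocus {k : ℕ} (S : Set (MvPolynomial (Fin (k + 1)) ℂ)) : Set (ProjSpace k) :=
  {x | ∀ p ∈ S, eval x.coords p = 0}

/-- The algebraic subsets of `P^k` (equivalently, by Chow's theorem, its analytic subsets): the
common zero sets of homogeneous polynomials. -/
def IsAlgebraic {k : ℕ} (A : Set (ProjSpace k)) : Prop :=
  ∃ S : Set (MvPolynomial (Fin (k + 1)) ℂ), (∀ p ∈ S, ∃ d, p.IsHomogeneous d) ∧ A = zeroLocus S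

/-- The Zariski topology: the closed sets are the algebraic (that is, the analytic) subsets. -/
instance (k : ℕ) : TopologicalSpace (ProjSpace k) :=
  TopologicalSpace.ofClosed {A | IsAlgebraic A}
    ⟨{1}, by simpa using ⟨0, isHomogeneous_one _ _⟩, by
      ext x; simp [zeroLocus]⟩
    (by
      intro 𝒜 h𝒜
      choose S hS using fun A : 𝒜 => h𝒜 A.2
      refine ⟨⋃ A, S A, ?_, ?_⟩
      · intro p hp
        obtain ⟨A, hp⟩ := Set.mem_iUnion.1 hp
        exact (hS A).1 p hp
      · ext x
        constructor
        · intro h p hp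
          obtain ⟨A, hp⟩ := Set.mem_iUnion.1 hp
          have := h A.1 A.2
          rw [(hS A).2] at this
          exact this p hp
        · intro h A hA
          have := (hS ⟨A, hA⟩).2
          simp only at this
          rw [this]
          exact fun p hp => h p (Set.mem_iUnion.2 ⟨⟨A, hA⟩, hp⟩))
    (by
      rintro _ ⟨S, hS, rfl⟩ _ ⟨T, hT, rfl⟩
      refine ⟨{r | ∃ p ∈ S, ∃ q ∈ T, r = p * q}, ?_, ?_⟩
      · rintro _ ⟨p, hp, q, hq, rfl⟩
        obtain ⟨a, ha⟩ := hS p hp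
        obtain ⟨b, hb⟩ := hT q hq
        exact ⟨a + b, ha.mul hb⟩
      · ext x
        constructor
        · rintro (h | h) _ ⟨p, hp, q, hq, rfl⟩
          · simp [h p hp]
          · simp [h q hq]
        · intro h
          by_contra hx
          simp only [Set.mem_union, zeroLocus, Set.mem_ofPred_eq, not_or, not_forall] at hx
          obtain ⟨⟨p, hp, hp'⟩, ⟨q, hq, hq'⟩⟩ := hx
          have := h (p * q) ⟨p, hp, q, hq, rfl⟩
          simp_all)

theorem isClosed_iff {k : ℕ} (A : Set (ProjSpace k)) : IsClosed A ↔ IsAlgebraic A := by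
  rw [← isOpen_compl_iff]
  change Aᶜᶜ ∈ {A | IsAlgebraic A} ↔ _
  simp

/-- The codimension of a closed subset `A` of `P^k`: the infimum over the irreducible closed
`Z ⊆ A` of the supremum of the lengths of the chains `Z = Z₀ ⊊ Z₁ ⊊ ⋯ ⊊ Zₙ` of irreducible closed
subsets of `P^k`. The codimension of the empty set is `⊤`. -/
def codim {k : ℕ} (A : Set (ProjSpace k)) : ℕ∞ :=
  ⨅ Z : TopologicalSpace.IrreducibleCloseds (ProjSpace k), ⨅ _ : (Z : Set (ProjSpace k)) ⊆ A,
    Order.coheight Z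

/-- `Z` is an irreducible component of `A`, i.e. a maximal irreducible subset of `A`. -/
def IsComponent {k : ℕ} (Z A : Set (ProjSpace k)) : Prop :=
  Maximal (fun Y : Set (ProjSpace k) => IsIrreducible Y ∧ Y ⊆ A) Z

/-- A hypersurface: a nonempty closed subset of pure codimension `1`. -/
def IsHypersurface {k : ℕ} (H : Set (ProjSpace k)) : Prop :=
  IsClosed H ∧ H.Nonempty ∧ ∀ Z, IsComponent Z H → codim Z = 1

end ProjSpace

/-! ### Dominating meromorphic self-maps -/

/-- The Jacobian matrix of a polynomial self-map of `ℂ^{k+1}`. -/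
def polyJacobian {k : ℕ} (F : Fin (k + 1) → MvPolynomial (Fin (k + 1)) ℂ) :
    Matrix (Fin (k + 1)) (Fin (k + 1)) (MvPolynomial (Fin (k + 1)) ℂ) :=
  Matrix.of fun i j => pderiv j (F i)

/-- A dominating meromorphic self-map `f = [F_0 : ⋯ : F_k]` of `P^k`, given by a lifting
`F = (F_0, …, F_k)`: homogeneous polynomials of the same degree without nontrivial common factor.
That `f` has generically maximal rank `k` is expressed by the Jacobian determinant of the lifting:
where `F z ≠ 0`, the derivative of `F` maps the line `ℂ z` onto the line `ℂ F(z)`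
by Euler's identity (if the degree is positive), hence it is invertible at `z` if and only if
the derivative of `f` at `[z]` is; in degree zero `f` is constant and the determinant vanishes. -/
structure DominatingMap (k : ℕ) where
  /-- the algebraic degree -/
  deg : ℕ
  /-- the lifting -/
  F : Fin (k + 1) → MvPolynomial (Fin (k + 1)) ℂ
  homogeneous : ∀ i, (F i).IsHomogeneous deg
  coprime : ∀ q : MvPolynomial (Fin (k + 1)) ℂ, (∀ i, q ∣ F i) → IsUnit q
  dominating : (polyJacobian F).det ≠ 0

namespace DominatingMap

/-! #### Auxiliary facts for the composition -/

theorem pderiv_bind₁' {σ τ : Type*} [Fintype σ] (f : σ → MvPolynomial τ ℂ) (j : τ)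
    (p : MvPolynomial σ ℂ) :
    pderiv j (bind₁ f p) = ∑ i, bind₁ f (pderiv i p) * pderiv j (f i) := by
  classical
  induction p using MvPolynomial.induction_on with
  | C a => simp
  | add p q hp hq => simp [hp, hq, add_mul, Finset.sum_add_distrib]
  | mul_X p i hp =>
    have h1 : ∀ x, bind₁ f (pderiv x (p * X i)) * pderiv j (f x) =
        bind₁ f (pderiv x p) * pderiv j (f x) * f i +
          (if x = i then bind₁ f p * pderiv j (f i) else 0) := by
      intro x
      by_cases hx : x = i
      · subst hx
        rw [pderiv_mul, pderiv_X_self, map_add, map_mul, map_mul, bind₁_X_right, map_one, if_pos rfl]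
        ring
      · rw [pderiv_mul, pderiv_X_of_ne (Ne.symm hx), map_add, map_mul, map_mul, bind₁_X_right,
          map_zero, if_neg hx]
        ring
    rw [Finset.sum_congr rfl fun x _ => h1 x, Finset.sum_add_distrib, ← Finset.sum_mul, ← hp,
      Finset.sum_ite_eq' Finset.univ i, if_pos (Finset.mem_univ _), map_mul, bind₁_X_right,
      pderiv_mul]

theorem bind₁_ne_zero {k : ℕ} {f : Fin (k + 1) → MvPolynomial (Fin (k + 1)) ℂ}
    (hf : (polyJacobian f).det ≠ 0) {p : MvPolynomial (Fin (k + 1)) ℂ} (hp : p ≠ 0) :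
    bind₁ f p ≠ 0 := by
  classical
  induction hn : p.totalDegree using Nat.strong_induction_on generalizing p with
  | _ n ih =>
  intro h0
  have h1 : (fun i => bind₁ f (pderiv i p)) = 0 := by
    refine Matrix.eq_zero_of_vecMul_eq_zero hf ?_
    funext j
    have := pderiv_bind₁' f j p
    rw [h0, map_zero] at this
    simpa [Matrix.vecMul, dotProduct, polyJacobian] using this.symm
  have h2 : ∀ i, pderiv i p = 0 := by
    intro i
    by_contra hi
    refine ih _ ?_ hi rfl (congrFun h1 i)
    subst hn
    have key : ∀ m ∈ (pderiv i p).support, (m.sum fun _ e => e) + 1 ≤ p.totalDegree := by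
      intro m hm
      rw [mem_support_iff, coeff_pderiv] at hm
      have := le_totalDegree (mem_support_iff.2 (left_ne_zero_of_mul hm))
      rwa [Finsupp.sum_add_index' (fun _ => rfl) (fun _ _ _ => rfl),
        Finsupp.sum_single_index rfl] at this
    obtain ⟨m, hm⟩ := support_nonempty.2 hi
    refine (Finset.sup_lt_iff (lt_of_lt_of_le (Nat.succ_pos _) (key m hm))).2 ?_
    exact fun m hm => key m hm
  have h3 : p = C (coeff 0 p) := by
    ext m
    rw [coeff_C]
    split_ifs with hm
    · rw [hm]
    · obtain ⟨i, hi⟩ : ∃ i, m i ≠ 0 := by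
        by_contra! h
        exact hm (Finsupp.ext fun i => (h i).symm)
      have hm' : m - Finsupp.single i 1 + Finsupp.single i 1 = m := by
        refine tsub_add_cancel_of_le ?_
        rw [Finsupp.single_le_iff]
        exact Nat.one_le_iff_ne_zero.2 hi
      have := coeff_pderiv (i := i) p (m - Finsupp.single i 1)
      rw [h2 i, coeff_zero, hm'] at this
      rcases mul_eq_zero.1 this.symm with h | h
      · exact h
      · exact absurd h (Nat.cast_add_one_ne_zero _)
  rw [h3] at h0 hp
  rw [bind₁_C_right] at h0
  exact hp h0

/-- The homogeneous components of `p`, as coefficients of a polynomial in an extra variable. -/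
def grade {σ : Type*} : MvPolynomial σ ℂ →ₐ[ℂ] Polynomial (MvPolynomial σ ℂ) :=
  aeval fun i => Polynomial.C (X i) * Polynomial.X

theorem grade_monomial {σ : Type*} (m : σ →₀ ℕ) (a : ℂ) :
    grade (monomial m a) = Polynomial.monomial m.degree (monomial m a) := by
  rw [grade, aeval_monomial, ← Polynomial.C_mul_X_pow_eq_monomial, monomial_eq (s := m)]
  simp only [Finsupp.prod, mul_pow, Finset.prod_mul_distrib, Finset.prod_pow_eq_pow_sum,
    ← map_pow, ← map_prod, Polynomial.C_mul, Finsupp.degree_apply]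
  rw [← mul_assoc]
  rfl

theorem coeff_grade {σ : Type*} (p : MvPolynomial σ ℂ) (n : ℕ) :
    (grade p).coeff n = homogeneousComponent n p := by
  induction p using MvPolynomial.induction_on' with
  | monomial m a =>
    rw [grade_monomial, Polynomial.coeff_monomial,
      homogeneousComponent_of_mem (n := m.degree)
        ((mem_homogeneousSubmodule _ _).2 (isHomogeneous_monomial a rfl))]
    simp [eq_comm]
  | add p q hp hq => simp [hp, hq]

theorem grade_ne_zero {σ : Type*} {p : MvPolynomial σ ℂ} (hp : p ≠ 0) : grade p ≠ 0 := by
  intro h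
  apply hp
  rw [← sum_homogeneousComponent p]
  exact Finset.sum_eq_zero fun n _ => by rw [← coeff_grade, h, Polynomial.coeff_zero]

theorem isHomogeneous_of_grade {σ : Type*} {p : MvPolynomial σ ℂ} {n : ℕ}
    (h : ∀ m, m ≠ n → (grade p).coeff m = 0) : p.IsHomogeneous n := by
  have : p = homogeneousComponent n p := by
    conv_lhs => rw [← sum_homogeneousComponent p]
    by_cases hn : n < p.totalDegree + 1
    · rw [Finset.sum_eq_single n]
      · intro m _ hm
        rw [← coeff_grade, h m hm]
      · intro h'
        exact absurd (Finset.mem_range.2 hn) h'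
    · rw [homogeneousComponent_eq_zero n p (by omega)]
      exact Finset.sum_eq_zero fun m hm => by
        rw [← coeff_grade, h m]
        have := Finset.mem_range.1 hm
        omega
  rw [this]
  exact homogeneousComponent_isHomogeneous n p

theorem isHomogeneous_of_mul {σ : Type*} {p q : MvPolynomial σ ℂ} {n : ℕ} (hpq : p * q ≠ 0)
    (h : (p * q).IsHomogeneous n) :
    ∃ a b, p.IsHomogeneous a ∧ q.IsHomogeneous b ∧ a + b = n := by
  have hp := grade_ne_zero (left_ne_zero_of_mul hpq)
  have hq := grade_ne_zero (right_ne_zero_of_mul hpq)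
  have hg : grade (p * q) = Polynomial.monomial n (p * q) := by
    ext1 m
    rw [coeff_grade, homogeneousComponent_of_mem ((mem_homogeneousSubmodule _ _).2 h),
      Polynomial.coeff_monomial]
    simp [eq_comm]
  have h1 : (grade p).natDegree + (grade q).natDegree = n := by
    rw [← Polynomial.natDegree_mul hp hq, ← map_mul, hg, Polynomial.natDegree_monomial_eq _ hpq]
  have h2 : (grade p).natTrailingDegree + (grade q).natTrailingDegree = n := by
    rw [← Polynomial.natTrailingDegree_mul hp hq, ← map_mul, hg,
      Polynomial.natTrailingDegree_monomial hpq]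
  have h3 := Polynomial.natTrailingDegree_le_natDegree (grade p)
  have h4 := Polynomial.natTrailingDegree_le_natDegree (grade q)
  have aux : ∀ r : Polynomial (MvPolynomial σ ℂ), r.natTrailingDegree = r.natDegree →
      ∀ m, m ≠ r.natDegree → r.coeff m = 0 := by
    intro r hr m hm
    rcases lt_or_gt_of_ne hm with hm | hm
    · exact Polynomial.coeff_eq_zero_of_lt_natTrailingDegree (hr ▸ hm)
    · exact Polynomial.coeff_eq_zero_of_natDegree_lt hm
  exact ⟨_, _, isHomogeneous_of_grade (aux _ (by omega)), isHomogeneous_of_grade (aux _ (by omega)),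
    h1⟩

/-- Removing a common factor from a homogeneous tuple preserves nonvanishing of the Jacobian. -/
theorem jacobian_of_mul {k : ℕ} (q : MvPolynomial (Fin (k + 1)) ℂ)
    {G : Fin (k + 1) → MvPolynomial (Fin (k + 1)) ℂ} {e : ℕ} (hG : ∀ i, (G i).IsHomogeneous e)
    (hk : k ≠ 0)
    (h : (polyJacobian fun i => q * G i).det ≠ 0) : (polyJacobian G).det ≠ 0 := by
  have hJ : polyJacobian (fun i => q * G i) =
      q • polyJacobian G + Matrix.vecMulVec G (fun j => pderiv j q) := by
    ext1 i j
    simp [polyJacobian, Matrix.vecMulVec]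
  rw [hJ] at h
  by_cases he : e = 0
  · subst he
    have h0 : polyJacobian G = 0 := by
      ext1 i j
      have := (totalDegree_zero_iff_isHomogeneous _).2 (hG i)
      rw [totalDegree_eq_zero_iff_eq_C] at this
      simp only [polyJacobian, Matrix.of_apply, Matrix.zero_apply]
      rw [this, pderiv_C]
    have : Nontrivial (Fin (k + 1)) := Fin.nontrivial_iff_two_le.2 (by omega)
    rw [h0, smul_zero, zero_add, Matrix.det_vecMulVec] at h
    exact absurd rfl h
  · have hE : G = (polyJacobian G).mulVec fun j => C ((e : ℂ)⁻¹) * X j := by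
      funext i
      have := (hG i).sum_X_mul_pderiv
      simp only [Matrix.mulVec, dotProduct, polyJacobian, Matrix.of_apply]
      calc G i = C ((e : ℂ)⁻¹) * (e • G i) := by
            rw [nsmul_eq_mul, ← mul_assoc, ← map_natCast C, ← C_mul,
              inv_mul_cancel₀ (Nat.cast_ne_zero.2 he), C_1, one_mul]
        _ = _ := by
            rw [← this, Finset.mul_sum]
            exact Finset.sum_congr rfl fun j _ => by ring
    have : q • polyJacobian G + Matrix.vecMulVec G (fun j => pderiv j q) = polyJacobian G *
        (q • (1 : Matrix (Fin (k + 1)) (Fin (k + 1)) (MvPolynomial (Fin (k + 1)) ℂ)) +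
          Matrix.vecMulVec (fun j => C ((e : ℂ)⁻¹) * X j) (fun j => pderiv j q)) := by
      rw [mul_add, Matrix.mul_smul, mul_one, Matrix.mul_vecMulVec, ← hE]
    rw [this, Matrix.det_mul] at h
    exact left_ne_zero_of_mul h

theorem k_ne_zero {k : ℕ} (f : DominatingMap k) : k ≠ 0 := by
  rintro rfl
  have hu : IsUnit (f.F 0) := f.coprime _ fun i => by rw [Fin.fin_one_eq_zero i]
  have hC := MvPolynomial.isUnit_iff_eq_C_of_isReduced.1 hu
  obtain ⟨c, -, hc⟩ := hC
  apply f.dominating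
  rw [Matrix.det_fin_one]
  simp [polyJacobian, hc]

theorem exists_comp {k : ℕ} (g f : DominatingMap k) :
    ∃ h : DominatingMap k, ∃ q : MvPolynomial (Fin (k + 1)) ℂ, q ≠ 0 ∧
      ∀ i, bind₁ f.F (g.F i) = q * h.F i := by
  classical
  let _ : NormalizedGCDMonoid (MvPolynomial (Fin (k + 1)) ℂ) :=
    Classical.arbitrary _
  set P : Fin (k + 1) → MvPolynomial (Fin (k + 1)) ℂ := fun i => bind₁ f.F (g.F i) with hP
  obtain ⟨G, hG, hG1⟩ := Finset.univ.extract_gcd P ⟨0, Finset.mem_univ _⟩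
  set q := Finset.univ.gcd P with hq
  have hPh : ∀ i, (P i).IsHomogeneous (f.deg * g.deg) := fun i =>
    (g.homogeneous i).aeval _ f.homogeneous
  have hjac : (polyJacobian P).det ≠ 0 := by
    have : polyJacobian P = (bind₁ f.F).mapMatrix (polyJacobian g.F) * polyJacobian f.F := by
      ext1 i j
      simp only [polyJacobian, Matrix.of_apply, Matrix.mul_apply, hP, pderiv_bind₁']
      rfl
    rw [this, Matrix.det_mul, ← AlgHom.map_det]
    exact mul_ne_zero (bind₁_ne_zero f.dominating g.dominating) f.dominating
  obtain ⟨i₀, hi₀⟩ : ∃ i, P i ≠ 0 := by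
    by_contra! h
    apply hjac
    refine Matrix.det_eq_zero_of_row_eq_zero 0 fun j => ?_
    simp [polyJacobian, h 0]
  have hGP : ∀ i, P i = q * G i := fun i => hG i (Finset.mem_univ _)
  have hq0 : q ≠ 0 := by
    intro h0
    exact hi₀ (by rw [hGP, h0, zero_mul])
  obtain ⟨a, b, ha, -, -⟩ := isHomogeneous_of_mul (hGP i₀ ▸ hi₀) (hGP i₀ ▸ hPh i₀)
  have hGh : ∀ i, (G i).IsHomogeneous (f.deg * g.deg - a) := by
    intro i
    by_cases hi : G i = 0
    · rw [hi]
      exact isHomogeneous_zero _ _ _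
    · have hne : q * G i ≠ 0 := mul_ne_zero hq0 hi
      obtain ⟨a', b', ha', hb', hab⟩ := isHomogeneous_of_mul hne (hGP i ▸ hPh i)
      have := ha.inj_right ha' hq0
      rw [← hab, this, Nat.add_sub_cancel_left]
      exact hb'
  have hGc : ∀ r : MvPolynomial (Fin (k + 1)) ℂ, (∀ i, r ∣ G i) → IsUnit r := fun r hr =>
    isUnit_of_dvd_one (hG1 ▸ Finset.dvd_gcd fun i _ => hr i)
  refine ⟨⟨_, G, hGh, hGc, ?_⟩, q, hq0, hGP⟩
  refine jacobian_of_mul q hGh f.k_ne_zero ?_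
  rwa [← (funext hGP : P = fun i => q * G i)]

/-- The composition `g ∘ f`: its lifting is `G ∘ F` divided by the greatest common divisor of the
components of `G ∘ F` (it is determined up to a nonzero constant). -/
def comp {k : ℕ} (g f : DominatingMap k) : DominatingMap k := (exists_comp g f).choose

theorem comp_spec {k : ℕ} (g f : DominatingMap k) : ∃ q : MvPolynomial (Fin (k + 1)) ℂ, q ≠ 0 ∧
    ∀ i, bind₁ f.F (g.F i) = q * (g.comp f).F i := (exists_comp g f).choose_spec

/-- `f.iterateSucc n` is the iterate `f^{n+1}`: `f^1 = f` and `f^{n+1} = f^n ∘ f`. -/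
def iterateSucc {k : ℕ} (f : DominatingMap k) : ℕ → DominatingMap k
  | 0 => f
  | n + 1 => (iterateSucc f n).comp f

/-! #### Indeterminacy, images, stability -/

/-- The indeterminacy locus of `f`. -/
def indet {k : ℕ} (f : DominatingMap k) : Set (ProjSpace k) := ProjSpace.zeroLocus (Set.range f.F)

/-- The value of a lifting of `f` at homogeneous coordinates of the point `x`. -/
def value {k : ℕ} (f : DominatingMap k) (x : ProjSpace k) : Fin (k + 1) → ℂ :=
  fun i => eval x.coords (f.F i)

theorem value_ne_zero {k : ℕ} (f : DominatingMap k) {x : ProjSpace k} (hx : x ∉ f.indet) :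
    f.value x ≠ 0 := by
  intro h
  apply hx
  rintro _ ⟨i, rfl⟩
  exact congrFun h i

/-- The map `f : P^k \ I(f) → P^k`. -/
def apply {k : ℕ} (f : DominatingMap k) (x : ProjSpace k) (hx : x ∉ f.indet) : ProjSpace k :=
  ProjSpace.mk (f.value x) (f.value_ne_zero hx)

/-- The image `f(A)`: the closure of `f(A \ I(f))`. -/
def image {k : ℕ} (f : DominatingMap k) (A : Set (ProjSpace k)) : Set (ProjSpace k) :=
  closure {y | ∃ x, ∃ hx : x ∉ f.indet, x ∈ A ∧ f.apply x hx = y}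

/-- The image `f^n(A)` of `A` under the meromorphic map `f^n`, with `f^0(A) = A`. -/
def iterImage {k : ℕ} (f : DominatingMap k) : ℕ → Set (ProjSpace k) → Set (ProjSpace k)
  | 0, A => A
  | n + 1, A => (f.iterateSucc n).image A

/-- `n` is the smallest integer `n ≥ 1` with `f^n(A) ⊆ I(f)`. -/
def HasHeight {k : ℕ} (f : DominatingMap k) (A : Set (ProjSpace k)) (n : ℕ) : Prop :=
  IsLeast {m | 1 ≤ m ∧ f.iterImage m A ⊆ f.indet} n

/-- A degree lowering hypersurface `H` of `f` with height `n`. -/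
def IsDegreeLowering {k : ℕ} (f : DominatingMap k) (H : Set (ProjSpace k)) (n : ℕ) : Prop :=
  ProjSpace.IsHypersurface H ∧ f.HasHeight H n

/-- `f` is algebraically stable: no hypersurface is sent by some iterate of `f` into `I(f)`. -/
def IsAlgebraicallyStable {k : ℕ} (f : DominatingMap k) : Prop :=
  ¬ ∃ (H : Set (ProjSpace k)) (N : ℕ),
    ProjSpace.IsHypersurface H ∧ 1 ≤ N ∧ f.iterImage N H ⊆ f.indet

/-- `H_1, …, H_M` are degree lowering hypersurfaces with heights `n_1, …, n_M`, all irreducible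
components of `H_j` having the same height `n_j`, such that
* the heights `n_j` are pairwise different;
* `codim f^m(H_j) > 1` for `1 ≤ m ≤ n_j`;
* every irreducible degree lowering hypersurface `H` has, before the time at which it is sent into
  `I(f)` (its height `h`), an image `f^n(H)` that is a hypersurface contained in some `H_j`. -/
structure IsPrimitiveFamily {k : ℕ} (f : DominatingMap k) (M : ℕ) (H : Fin M → Set (ProjSpace k))
    (n : Fin M → ℕ) : Prop where
  degreeLowering : ∀ j, f.IsDegreeLowering (H j) (n j)
  component : ∀ j Z, ProjSpace.IsComponent Z (H j) → f.HasHeight Z (n j)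
  injective : Function.Injective n
  codim : ∀ j m, 1 ≤ m → m ≤ n j → 1 < ProjSpace.codim (f.iterImage m (H j))
  lands : ∀ (A : Set (ProjSpace k)) (h : ℕ), IsIrreducible A → f.IsDegreeLowering A h →
    ∃ m < h, ∃ j, ProjSpace.IsHypersurface (f.iterImage m A) ∧ f.iterImage m A ⊆ H j

end DominatingMap

end

/-!
For an irreducible set `A` none of whose first `n` images lies in `I(f)`, the homogeneous ideal of
`f^n(A)` is the preimage of the ideal of `A` under composition with the `n`-th iterate of the
lifting of `f`. Hence such images are irreducible and compose as expected, although common factors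
are removed from the liftings of the iterates.

Call an irreducible degree lowering hypersurface primitive if its images up to the time of its
height all have codimension greater than one. The last hypersurface among the images of an
irreducible degree lowering hypersurface, before it is sent into `I(f)`, is primitive. A primitive
hypersurface `{p = 0}` is contracted by `f`, which forces `p` to divide the Jacobian determinant of
the lifting; so there are finitely many of them. Grouping them by height gives the `H_j`.
Conversely, a primitive hypersurface has no image that is a hypersurface other than itself, so in
any family as in the theorem the components of the `H_j` are exactly the primitive hypersurfaces.
This gives uniqueness.
-/

/-! ### Polynomial algebra -/

theorem totalDegree_pderiv_lt {R σ : Type*} [CommSemiring R] {p : MvPolynomial σ R} {i : σ}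
    (hi : pderiv i p ≠ 0) : (pderiv i p).totalDegree < p.totalDegree := by
  classical
  have degree_lt : ∀ m ∈ (pderiv i p).support, (m.sum fun _ e => e) < p.totalDegree := by
    intro m hm
    rw [mem_support_iff, coeff_pderiv] at hm
    have := le_totalDegree (mem_support_iff.2 (left_ne_zero_of_mul hm))
    rwa [Finsupp.sum_add_index' (fun _ => rfl) (fun _ _ _ => rfl),
      Finsupp.sum_single_index rfl] at this
  obtain ⟨m, hm⟩ := support_nonempty.2 hi
  exact (Finset.sup_lt_iff (Nat.zero_lt_of_lt (degree_lt m hm))).2 degree_lt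

theorem eq_C_of_pderiv_eq_zero {R σ : Type*} [CommSemiring R] [NoZeroDivisors R] [CharZero R]
    {p : MvPolynomial σ R} (h : ∀ i, pderiv i p = 0) : p = C (coeff 0 p) := by
  classical
  ext m
  rw [coeff_C]
  split_ifs with hm
  · rw [hm]
  · obtain ⟨i, hi⟩ := Finsupp.ne_iff.1 (Ne.symm hm)
    have hm' : m - Finsupp.single i 1 + Finsupp.single i 1 = m :=
      tsub_add_cancel_of_le (Finsupp.single_le_iff.2 (Nat.one_le_iff_ne_zero.2 hi))
    have := coeff_pderiv (i := i) p (m - Finsupp.single i 1)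
    rw [h i, coeff_zero, hm'] at this
    exact (mul_eq_zero.1 this.symm).resolve_right (Nat.cast_add_one_ne_zero _)

theorem pderiv_comm {R σ : Type*} [CommSemiring R] (i j : σ) (p : MvPolynomial σ R) :
    pderiv i (pderiv j p) = pderiv j (pderiv i p) := by
  classical
  obtain rfl | hij := eq_or_ne i j
  · rfl
  · ext m
    simp only [coeff_pderiv, Finsupp.add_apply, Finsupp.single_eq_of_ne hij,
      Finsupp.single_eq_of_ne (Ne.symm hij), add_zero]
    rw [add_right_comm]
    ring

theorem exists_C_mem_span_pair {R : Type*} [CommRing R] [IsDomain R] [UniqueFactorizationMonoid R]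
    {g h : Polynomial R} (hg : Irreducible g) (hd : g.natDegree ≠ 0) (hgh : ¬ g ∣ h) :
    ∃ r : R, r ≠ 0 ∧ Polynomial.C r ∈ Ideal.span {g, h} := by
  classical
  let _ : NormalizedGCDMonoid R := Classical.arbitrary _
  let φ := algebraMap R (FractionRing R)
  have hφ : Function.Injective φ := IsFractionRing.injective R (FractionRing R)
  have hprim : g.IsPrimitive := hg.isPrimitive hd
  have hcoprime : IsCoprime (g.map φ) (h.map φ) :=
    ((hprim.irreducible_iff_irreducible_map_fraction_map.1 hg).coprime_iff_not_dvd).2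
      fun hdvd => hgh (hprim.dvd_of_fraction_map_dvd_fraction_map hdvd)
  refine ⟨g.resultant h, fun h0 => Polynomial.resultant_ne_zero _ _ hcoprime ?_, ?_⟩
  · rw [Polynomial.natDegree_map_eq_of_injective hφ, Polynomial.natDegree_map_eq_of_injective hφ,
      Polynomial.resultant_map_map, h0, map_zero]
  · obtain ⟨a, b, -, -, hab⟩ :=
      Polynomial.exists_mul_add_mul_eq_C_resultant g h le_rfl le_rfl (Or.inl hd)
    exact Ideal.mem_span_pair.2 ⟨a, b, by rw [← hab]; ring⟩

theorem pderiv_rename_eq_zero {R σ τ : Type*} [CommSemiring R] {f : τ → σ} {i : σ}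
    (hi : i ∉ Set.range f) (p : MvPolynomial τ R) : pderiv i (rename f p) = 0 := by
  classical
  refine pderiv_eq_zero_of_notMem_vars fun hmem => hi ?_
  obtain ⟨j, -, hj⟩ := Finset.mem_image.1 (vars_rename f p hmem)
  exact ⟨j, hj⟩

theorem exists_mem_span_pair_pderiv_eq_zero {R σ : Type*} [CommRing R] [IsDomain R]
    [UniqueFactorizationMonoid R] {g h : MvPolynomial σ R} {i : σ} (hg : Irreducible g)
    (hi : pderiv i g ≠ 0) (hgh : ¬ g ∣ h) :
    ∃ w ∈ Ideal.span {g, h}, w ≠ 0 ∧ pderiv i w = 0 := by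
  classical
  let e : MvPolynomial σ R ≃ₐ[R] Polynomial (MvPolynomial {j // j ≠ i} R) :=
    (renameEquiv R (Equiv.optionSubtypeNe i).symm).trans (optionEquivLeft R _)
  have symm_C : ∀ r, e.symm (Polynomial.C r) = rename (↑) r := by
    refine DFunLike.congr_fun (f := e.symm.toAlgHom.comp Polynomial.CAlgHom) ?_
    ext1 j
    simp [e]
  have pderiv_symm_C : ∀ r, pderiv i (e.symm (Polynomial.C r)) = 0 := fun r => by
    rw [symm_C]
    exact pderiv_rename_eq_zero (by simp) r
  have natDegree_ne : (e g).natDegree ≠ 0 := fun h0 => by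
    obtain ⟨r, hr⟩ := Polynomial.natDegree_eq_zero.1 h0
    exact hi (by rw [← pderiv_symm_C r, hr, AlgEquiv.symm_apply_apply])
  obtain ⟨r, hr, hmem⟩ := exists_C_mem_span_pair ((MulEquiv.irreducible_iff e).2 hg) natDegree_ne
    (h := e h) fun hdvd => hgh ((map_dvd_iff e).1 hdvd)
  refine ⟨e.symm (Polynomial.C r), ?_, by simpa using hr, pderiv_symm_C r⟩
  obtain ⟨a, b, hab⟩ := Ideal.mem_span_pair.1 hmem
  exact Ideal.mem_span_pair.2 ⟨e.symm a, e.symm b, by simp [← hab]⟩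

theorem exists_mem_pderiv_notMem {K σ : Type*} [Field K] [CharZero K]
    {Q : Ideal (MvPolynomial σ K)} (hQ : Q ≠ ⊤) {w : MvPolynomial σ K} (hw : w ∈ Q)
    (hw0 : w ≠ 0) :
    ∃ v ∈ Q, (∀ i, pderiv i w = 0 → pderiv i v = 0) ∧ ∃ j, pderiv j v ∉ Q := by
  induction hn : w.totalDegree using Nat.strong_induction_on generalizing w with
  | _ n ih =>
  obtain ⟨j, hj⟩ : ∃ j, pderiv j w ≠ 0 := by
    by_contra! h
    rw [eq_C_of_pderiv_eq_zero h] at hw hw0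
    have hc : coeff 0 w ≠ 0 := fun hc => hw0 (by rw [hc, C_0])
    exact hQ (Ideal.eq_top_of_isUnit_mem _ hw ((IsUnit.mk0 _ hc).map C))
  by_cases hjQ : pderiv j w ∈ Q
  · obtain ⟨v, hv, hwv, hvQ⟩ := ih _ (hn ▸ totalDegree_pderiv_lt hj) hjQ hj rfl
    exact ⟨v, hv, fun i hi => hwv i (by rw [pderiv_comm, hi, map_zero]), hvQ⟩
  · exact ⟨w, hw, fun _ h => h, j, hjQ⟩

theorem exists_irreducible_dvd_mem {R : Type*} [CommRing R] [IsDomain R]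
    [UniqueFactorizationMonoid R] {P : Ideal R} [hP : P.IsPrime] {a : R} (ha0 : a ≠ 0)
    (ha : a ∈ P) : ∃ p, Irreducible p ∧ p ∣ a ∧ p ∈ P := by
  obtain ⟨u, hu⟩ := UniqueFactorizationMonoid.factors_prod ha0
  have hmem : (UniqueFactorizationMonoid.factors a).prod ∈ P :=
    (hP.mem_or_mem (hu.symm.subst (motive := (· ∈ P)) ha)).resolve_right
      fun h => hP.ne_top (Ideal.eq_top_of_isUnit_mem _ h u.isUnit)
  obtain ⟨p, hp, hpP⟩ := (hP.multiset_prod_mem_iff_exists_mem _).1 hmem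
  exact ⟨p, UniqueFactorizationMonoid.irreducible_of_factor p hp,
    UniqueFactorizationMonoid.dvd_of_mem_factors hp, hpP⟩

theorem exists_irreducible_mem_pderiv_notMem {K σ : Type*} [Field K] [CharZero K]
    {Q : Ideal (MvPolynomial σ K)} [hQ : Q.IsPrime] (hQ0 : Q ≠ ⊥) :
    ∃ g ∈ Q, Irreducible g ∧ ∃ i, pderiv i g ∉ Q := by
  obtain ⟨w, hw, hw0⟩ := Submodule.exists_mem_ne_zero_of_ne_bot hQ0
  obtain ⟨v, hv, -, i, hi⟩ := exists_mem_pderiv_notMem hQ.ne_top hw hw0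
  have hv0 : v ≠ 0 := by
    rintro rfl
    exact hi (by simp)
  obtain ⟨g, hg, ⟨b, rfl⟩, hgQ⟩ := exists_irreducible_dvd_mem hv0 hv
  refine ⟨g, hgQ, hg, i, fun h => hi ?_⟩
  rw [pderiv_mul]
  exact Q.add_mem (Q.mul_mem_right _ h) (Q.mul_mem_right _ hgQ)

theorem eq_span_singleton_of_pderiv_minors_mem {K σ : Type*} [Field K] [CharZero K]
    {Q : Ideal (MvPolynomial σ K)} [hQ : Q.IsPrime] (hQ0 : Q ≠ ⊥)
    (hminor : ∀ g ∈ Q, ∀ w ∈ Q, ∀ i j,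
      pderiv i g * pderiv j w - pderiv j g * pderiv i w ∈ Q) :
    ∃ g, Irreducible g ∧ Q = Ideal.span {g} := by
  obtain ⟨g, hgQ, hg, i, hi⟩ := exists_irreducible_mem_pderiv_notMem hQ0
  refine ⟨g, hg, le_antisymm (fun h hhQ => ?_) ((Ideal.span_singleton_le_iff_mem _).2 hgQ)⟩
  rw [Ideal.mem_span_singleton]
  by_contra hgh
  have hi0 : pderiv i g ≠ 0 := fun h0 => hi (h0 ▸ Q.zero_mem)
  obtain ⟨w, hwgh, hw0, hwi⟩ := exists_mem_span_pair_pderiv_eq_zero hg hi0 hgh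
  have hwQ : w ∈ Q := Ideal.span_le.2 (Set.pair_subset hgQ hhQ) hwgh
  obtain ⟨v, hvQ, hwv, j, hj⟩ := exists_mem_pderiv_notMem hQ.ne_top hwQ hw0
  have := hminor g hgQ v hvQ i j
  rw [hwv i hwi, mul_zero, sub_zero] at this
  exact (hQ.mem_or_mem this).elim hi hj

theorem vecMul_minor_eq {n R : Type*} [Fintype n] [DecidableEq n] [CommRing R] [IsDomain R]
    {M : Matrix n n R} (hM : M.det ≠ 0) {x y v : n → R} {a b : R}
    (hx : Matrix.vecMul x M = a • v) (hy : Matrix.vecMul y M = b • v) (i j : n) :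
    x i * y j = x j * y i := by
  have hxy : b • x - a • y = 0 := Matrix.eq_zero_of_vecMul_eq_zero hM <| by
    rw [Matrix.sub_vecMul, Matrix.smul_vecMul, Matrix.smul_vecMul, hx, hy, smul_comm, sub_self]
  have hi := congrFun hxy i
  have hj := congrFun hxy j
  simp only [Pi.sub_apply, Pi.smul_apply, smul_eq_mul, Pi.zero_apply] at hi hj
  obtain rfl | hb := eq_or_ne b 0
  · have hy0 : y = 0 := Matrix.eq_zero_of_vecMul_eq_zero hM (by rw [hy, zero_smul])
    simp [hy0]
  · exact mul_left_cancel₀ hb (by linear_combination y j * hi - y i * hj)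

theorem dvd_bind₁_pderiv_minor {k : ℕ} {F : Fin (k + 1) → MvPolynomial (Fin (k + 1)) ℂ}
    {p : MvPolynomial (Fin (k + 1)) ℂ} (hp : Prime p) (hJ : ¬ p ∣ (polyJacobian F).det)
    {g w : MvPolynomial (Fin (k + 1)) ℂ} (hg : p ∣ bind₁ F g) (hw : p ∣ bind₁ F w)
    (i j : Fin (k + 1)) :
    p ∣ bind₁ F (pderiv i g * pderiv j w - pderiv j g * pderiv i w) := by
  have := (Ideal.span_singleton_prime hp.ne_zero).2 hp
  let φ := Ideal.Quotient.mk (Ideal.span {p})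
  have φ_eq_zero : ∀ {a}, φ a = 0 ↔ p ∣ a := fun {a} => by
    rw [Ideal.Quotient.eq_zero_iff_mem, Ideal.mem_span_singleton]
  have hdet : (φ.mapMatrix (polyJacobian F)).det ≠ 0 := by
    rwa [← RingHom.map_det, Ne, φ_eq_zero]
  have gradient : ∀ u a, bind₁ F u = p * a →
      Matrix.vecMul (fun s => φ (bind₁ F (pderiv s u))) (φ.mapMatrix (polyJacobian F)) =
        φ a • fun l => φ (pderiv l p) := by
    intro u a hu
    ext l
    have chain := congrArg φ (DominatingMap.pderiv_bind₁' F l u)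
    rw [hu, pderiv_mul, map_add, map_mul, map_mul, φ_eq_zero.2 dvd_rfl, zero_mul, add_zero,
      map_sum] at chain
    simpa [Matrix.vecMul, dotProduct, polyJacobian, mul_comm] using chain.symm
  obtain ⟨a, ha⟩ := hg
  obtain ⟨b, hb⟩ := hw
  rw [← φ_eq_zero, map_sub, map_mul, map_mul, map_sub, map_mul, map_mul, sub_eq_zero]
  exact vecMul_minor_eq hdet (gradient g a ha) (gradient w b hb) i j

theorem eq_bot_of_lt_span_singleton {R : Type*} [CommRing R] [IsDomain R] [WfDvdMonoid R]
    {P : Ideal R} [hP : P.IsPrime] {g : R} (hg : ¬ IsUnit g) (hlt : P < Ideal.span {g}) :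
    P = ⊥ := by
  have hgP : g ∉ P := fun h => hlt.not_ge ((Ideal.span_singleton_le_iff_mem _).2 h)
  by_contra hP0
  obtain ⟨x, hxP, hx0⟩ := Submodule.exists_mem_ne_zero_of_ne_bot hP0
  obtain ⟨n, y, hgy, rfl⟩ := WfDvdMonoid.max_power_factor' hx0 hg
  have hyP : y ∈ P := (hP.mem_or_mem hxP).resolve_left fun h => hgP (hP.mem_of_pow_mem _ h)
  exact hgy (Ideal.mem_span_singleton.1 (hlt.le hyP))

/-! ### Irreducible sets -/

theorem exists_maximal_isIrreducible_subset {X : Type*} [TopologicalSpace X] {Y A : Set X}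
    (hY : IsIrreducible Y) (h : Y ⊆ A) :
    ∃ Z, Y ⊆ Z ∧ Maximal (fun Z => IsIrreducible Z ∧ Z ⊆ A) Z := by
  refine zorn_subset_nonempty {Z | IsIrreducible Z ∧ Z ⊆ A}
    (fun c hc hchain ⟨s, hs⟩ => ?_) Y ⟨hY, h⟩
  refine ⟨⋃₀ c, ⟨⟨(hc hs).1.nonempty.mono (Set.subset_sUnion_of_mem hs), ?_⟩,
    Set.sUnion_subset fun t ht => (hc ht).2⟩, fun t ht => Set.subset_sUnion_of_mem ht⟩
  rintro u v hu hv ⟨y, ⟨p, hp, hyp⟩, hyu⟩ ⟨x, ⟨q, hq, hxq⟩, hxv⟩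
  obtain ⟨r, hr, hpr, hqr⟩ := hchain.directedOn p hp q hq
  obtain ⟨z, hz, hzuv⟩ := (hc hr).1.2 u v hu hv ⟨y, hpr hyp, hyu⟩ ⟨x, hqr hxq, hxv⟩
  exact ⟨z, ⟨r, hr, hz⟩, hzuv⟩

theorem exists_subset_of_isIrreducible_of_subset_sUnion {X : Type*} [TopologicalSpace X]
    {A : Set X} (hA : IsIrreducible A) {S : Set (Set X)} (hS : S.Finite) (hc : ∀ B ∈ S, IsClosed B)
    (h : A ⊆ ⋃₀ S) : ∃ B ∈ S, A ⊆ B := by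
  simpa using
    isIrreducible_iff_sUnion_isClosed.1 hA hS.toFinset (by simpa using hc) (by simpa using h)

/-! ### Zero sets and homogeneous ideals -/

/-- The restriction of a polynomial to the line spanned by `v`, as the polynomial `g (t v)` in `t`.
For `v ≠ 0` it vanishes if and only if every homogeneous component of `g` vanishes at the point
`[v]` of projective space, which gives a meaning to the vanishing of an inhomogeneous `g` there. -/
noncomputable def restrictLine {σ : Type*} (v : σ → ℂ) : MvPolynomial σ ℂ →ₐ[ℂ] Polynomial ℂ :=
  aeval fun i => Polynomial.C (v i) * Polynomial.X

section RestrictLine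

variable {σ : Type*} (v : σ → ℂ)

theorem restrictLine_X (i : σ) : restrictLine v (X i) = Polynomial.C (v i) * Polynomial.X :=
  aeval_X _ _

theorem eval_restrictLine (t : ℂ) (g : MvPolynomial σ ℂ) :
    (restrictLine v g).eval t = eval (t • v) g := by
  rw [← Polynomial.coe_aeval_eq_eval, ← coe_aeval_eq_eval]
  refine DFunLike.congr_fun (f := (Polynomial.aeval t).comp (restrictLine v))
    (g := aeval (t • v)) ?_ g
  ext i
  simp [restrictLine_X, mul_comm t]

theorem coeff_restrictLine (n : ℕ) (g : MvPolynomial σ ℂ) :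
    (restrictLine v g).coeff n = eval v (homogeneousComponent n g) := by
  have map_grade : restrictLine v = (Polynomial.mapAlgHom (aeval v)).comp DominatingMap.grade := by
    ext1 i
    simp [restrictLine_X, DominatingMap.grade]
  rw [map_grade, AlgHom.comp_apply, Polynomial.coe_mapAlgHom, Polynomial.coeff_map,
    DominatingMap.coeff_grade]
  rfl

theorem restrictLine_of_isHomogeneous {g : MvPolynomial σ ℂ} {d : ℕ} (hg : g.IsHomogeneous d) :
    restrictLine v g = Polynomial.monomial d (eval v g) := by
  ext n
  rw [coeff_restrictLine, homogeneousComponent_of_mem ((mem_homogeneousSubmodule _ _).2 hg),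
    Polynomial.coeff_monomial, apply_ite (eval v), map_zero]
  simp only [eq_comm]

theorem restrictLine_eq_zero_iff_of_isHomogeneous {g : MvPolynomial σ ℂ} {d : ℕ}
    (hg : g.IsHomogeneous d) : restrictLine v g = 0 ↔ eval v g = 0 := by
  rw [restrictLine_of_isHomogeneous v hg, Polynomial.monomial_eq_zero_iff]

variable {v}

theorem restrictLine_smul_eq_zero {g : MvPolynomial σ ℂ} (h : restrictLine v g = 0) (a : ℂ) :
    restrictLine (a • v) g = 0 := by
  have rescale : restrictLine (a • v) =
      (Polynomial.aeval (Polynomial.C a * Polynomial.X)).comp (restrictLine v) := by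
    ext1 i
    simp only [restrictLine_X, Pi.smul_apply, smul_eq_mul, AlgHom.comp_apply,
      map_mul, Polynomial.aeval_C, Polynomial.aeval_X, Polynomial.algebraMap_eq]
    ring
  rw [rescale, AlgHom.comp_apply, h, map_zero]

theorem restrictLine_smul_eq_zero_iff {g : MvPolynomial σ ℂ} {a : ℂ} (ha : a ≠ 0) :
    restrictLine (a • v) g = 0 ↔ restrictLine v g = 0 :=
  ⟨fun h => by simpa [smul_smul, ha] using restrictLine_smul_eq_zero h a⁻¹,
    fun h => restrictLine_smul_eq_zero h a⟩

theorem restrictLine_bind₁ {τ : Type*} {P : τ → MvPolynomial σ ℂ} {d : ℕ}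
    (hP : ∀ i, (P i).IsHomogeneous d) (g : MvPolynomial τ ℂ) :
    restrictLine v (bind₁ P g) =
      Polynomial.expand ℂ d (restrictLine (fun i => eval v (P i)) g) := by
  refine DFunLike.congr_fun (f := (restrictLine v).comp (bind₁ P))
    (g := (Polynomial.expand ℂ d).comp (restrictLine fun i => eval v (P i))) ?_ g
  ext1 i
  simp [restrictLine_X, restrictLine_of_isHomogeneous v (hP i),
    Polynomial.C_mul_X_pow_eq_monomial]

theorem restrictLine_bind₁_eq_zero_iff {τ : Type*} {P : τ → MvPolynomial σ ℂ} {d : ℕ} (hd : 0 < d)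
    (hP : ∀ i, (P i).IsHomogeneous d) (g : MvPolynomial τ ℂ) :
    restrictLine v (bind₁ P g) = 0 ↔ restrictLine (fun i => eval v (P i)) g = 0 := by
  rw [restrictLine_bind₁ hP, Polynomial.expand_eq_zero hd]

end RestrictLine

namespace ProjSpace

variable {k : ℕ} {A B : Set (ProjSpace k)}

theorem restrictLine_coords_mk_eq_zero_iff {v : Fin (k + 1) → ℂ} (hv : v ≠ 0)
    (g : MvPolynomial (Fin (k + 1)) ℂ) :
    restrictLine (mk v hv).coords g = 0 ↔ restrictLine v g = 0 := by
  obtain ⟨a, ha⟩ := (Projectivization.mk_eq_mk_iff ℂ _ _ (coords_ne_zero (mk v hv)) hv).1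
    (mk_coords (mk v hv))
  rw [← ha]
  exact restrictLine_smul_eq_zero_iff a.ne_zero

instance : Nonempty (ProjSpace k) := ⟨mk 1 one_ne_zero⟩

/-- The set of the points of `P^k` at which all homogeneous components of `g` vanish. -/
def zeroSet (g : MvPolynomial (Fin (k + 1)) ℂ) : Set (ProjSpace k) :=
  {x | restrictLine x.coords g = 0}

theorem isClosed_zeroSet (g : MvPolynomial (Fin (k + 1)) ℂ) : IsClosed (zeroSet g) := by
  rw [isClosed_iff]
  refine ⟨Set.range fun n => homogeneousComponent n g, ?_, ?_⟩
  · rintro _ ⟨n, rfl⟩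
    exact ⟨n, homogeneousComponent_isHomogeneous n g⟩
  · ext x
    simp [zeroSet, zeroLocus, Polynomial.ext_iff, coeff_restrictLine]

theorem zeroSet_mul (g h : MvPolynomial (Fin (k + 1)) ℂ) :
    zeroSet (g * h) = zeroSet g ∪ zeroSet h := by
  ext x
  simp [zeroSet]

theorem zeroSet_eq_of_associated {g h : MvPolynomial (Fin (k + 1)) ℂ} (hgh : Associated g h) :
    zeroSet g = zeroSet h := by
  obtain ⟨u, rfl⟩ := hgh
  ext x
  simp [zeroSet, (u.isUnit.map (restrictLine x.coords)).ne_zero]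

/-- The homogeneous ideal of `A`: the polynomials vanishing on the cone over `A`. -/
noncomputable def coneIdeal (A : Set (ProjSpace k)) : Ideal (MvPolynomial (Fin (k + 1)) ℂ) :=
  ⨅ x ∈ A, RingHom.ker (restrictLine x.coords)

theorem mem_coneIdeal {g : MvPolynomial (Fin (k + 1)) ℂ} :
    g ∈ coneIdeal A ↔ ∀ x ∈ A, restrictLine x.coords g = 0 := by
  simp [coneIdeal, Submodule.mem_iInf, RingHom.mem_ker]

theorem mem_coneIdeal_iff_subset_zeroSet {g : MvPolynomial (Fin (k + 1)) ℂ} :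
    g ∈ coneIdeal A ↔ A ⊆ zeroSet g := mem_coneIdeal

theorem coneIdeal_anti (h : A ⊆ B) : coneIdeal B ≤ coneIdeal A :=
  fun _ hg => mem_coneIdeal.2 fun x hx => mem_coneIdeal.1 hg x (h hx)

theorem coneIdeal_closure (A : Set (ProjSpace k)) : coneIdeal (closure A) = coneIdeal A :=
  le_antisymm (coneIdeal_anti subset_closure) fun g hg => mem_coneIdeal_iff_subset_zeroSet.2
    (closure_minimal (mem_coneIdeal_iff_subset_zeroSet.1 hg) (isClosed_zeroSet g))

theorem exists_isHomogeneous_mem_coneIdeal (hA : IsClosed A) {x : ProjSpace k} (hx : x ∉ A) :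
    ∃ g ∈ coneIdeal A, (∃ d, g.IsHomogeneous d) ∧ x ∉ zeroSet g := by
  obtain ⟨S, hS, rfl⟩ := (isClosed_iff A).1 hA
  simp only [zeroLocus, Set.mem_ofPred_eq, not_forall] at hx
  obtain ⟨g, hg, hgx⟩ := hx
  obtain ⟨d, hd⟩ := hS g hg
  have mem_zeroSet_iff := fun y : ProjSpace k =>
    restrictLine_eq_zero_iff_of_isHomogeneous y.coords hd
  exact ⟨g, mem_coneIdeal.2 fun y hy => (mem_zeroSet_iff y).2 (hy g hg), ⟨d, hd⟩,
    fun h => hgx ((mem_zeroSet_iff x).1 h)⟩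

theorem coneIdeal_le_coneIdeal_iff (hB : IsClosed B) : coneIdeal B ≤ coneIdeal A ↔ A ⊆ B := by
  refine ⟨fun h x hx => ?_, coneIdeal_anti⟩
  by_contra hxB
  obtain ⟨g, hg, -, hgx⟩ := exists_isHomogeneous_mem_coneIdeal hB hxB
  exact hgx (mem_coneIdeal.1 (h hg) x hx)

theorem coneIdeal_inj (hA : IsClosed A) (hB : IsClosed B) :
    coneIdeal A = coneIdeal B ↔ A = B :=
  ⟨fun h => ((coneIdeal_le_coneIdeal_iff hB).1 h.ge).antisymm
    ((coneIdeal_le_coneIdeal_iff hA).1 h.le), congrArg _⟩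

theorem coneIdeal_univ : coneIdeal (Set.univ : Set (ProjSpace k)) = ⊥ := by
  refine eq_bot_iff.2 fun g hg => (Submodule.mem_bot _).2 (MvPolynomial.funext fun v => ?_)
  obtain rfl | hv := eq_or_ne v 0
  · obtain ⟨x⟩ := (inferInstance : Nonempty (ProjSpace k))
    rw [← zero_smul ℂ x.coords, ← eval_restrictLine, mem_coneIdeal.1 hg x trivial,
      Polynomial.eval_zero, map_zero]
  · rw [← one_smul ℂ v, ← eval_restrictLine,
      (restrictLine_coords_mk_eq_zero_iff hv g).1 (mem_coneIdeal.1 hg _ trivial),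
      Polynomial.eval_zero, map_zero]

theorem coneIdeal_eq_bot_iff (hA : IsClosed A) : coneIdeal A = ⊥ ↔ A = Set.univ := by
  rw [← coneIdeal_univ, coneIdeal_inj hA isClosed_univ]

theorem isPrime_coneIdeal (hA : IsIrreducible A) : (coneIdeal A).IsPrime := by
  refine ⟨fun htop => ?_, fun {g h} hgh => ?_⟩
  · obtain ⟨x, hx⟩ := hA.nonempty
    simpa using mem_coneIdeal.1 ((Ideal.eq_top_iff_one _).1 htop) x hx
  · simp only [mem_coneIdeal_iff_subset_zeroSet, zeroSet_mul] at hgh ⊢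
    exact isPreirreducible_iff_isClosed_union_isClosed.1 hA.2 _ _ (isClosed_zeroSet g)
      (isClosed_zeroSet h) hgh

theorem isIrreducible_of_isPrime_coneIdeal (h : (coneIdeal A).IsPrime) : IsIrreducible A := by
  refine ⟨Set.nonempty_iff_ne_empty.2 ?_,
    isPreirreducible_iff_isClosed_union_isClosed.2 fun B C hB hC hBC => ?_⟩
  · rintro rfl
    exact h.ne_top ((Ideal.eq_top_iff_one _).2 (mem_coneIdeal.2 fun x hx => hx.elim))
  · by_contra! ⟨hAB, hAC⟩
    obtain ⟨x, hxA, hxB⟩ := Set.not_subset.1 hAB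
    obtain ⟨y, hyA, hyC⟩ := Set.not_subset.1 hAC
    obtain ⟨g, hg, -, hgx⟩ := exists_isHomogeneous_mem_coneIdeal hB hxB
    obtain ⟨g', hg', -, hgy⟩ := exists_isHomogeneous_mem_coneIdeal hC hyC
    have hgg' : g * g' ∈ coneIdeal A := by
      rw [mem_coneIdeal_iff_subset_zeroSet, zeroSet_mul]
      exact fun z hz => (hBC hz).imp (mem_coneIdeal.1 hg z) (mem_coneIdeal.1 hg' z)
    exact (h.mem_or_mem hgg').elim (fun h => hgx (mem_coneIdeal.1 h x hxA))
      fun h => hgy (mem_coneIdeal.1 h y hyA)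

theorem isIrreducible_univ : IsIrreducible (Set.univ : Set (ProjSpace k)) :=
  isIrreducible_of_isPrime_coneIdeal (coneIdeal_univ ▸ Ideal.isPrime_bot)

theorem coneIdeal_diff_zeroSet (hA : IsIrreducible A) {r : MvPolynomial (Fin (k + 1)) ℂ}
    (hr : r ∉ coneIdeal A) : coneIdeal (A \ zeroSet r) = coneIdeal A := by
  refine le_antisymm (fun g hg => ?_) (coneIdeal_anti Set.sdiff_subset)
  have hgr : g * r ∈ coneIdeal A := mem_coneIdeal.2 fun x hx => by
    by_cases hxr : x ∈ zeroSet r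
    · rw [map_mul, show restrictLine x.coords r = 0 from hxr, mul_zero]
    · rw [map_mul, mem_coneIdeal.1 hg x ⟨hx, hxr⟩, zero_mul]
  exact ((isPrime_coneIdeal hA).mem_or_mem hgr).resolve_right hr

/- Away from the zeros of `P i`, the points `[P x]` and `[Q x]` coincide. -/
theorem bind₁_mem_coneIdeal_iff_of_eq_mul (hA : IsIrreducible A) {q : MvPolynomial (Fin (k + 1)) ℂ}
    {P Q : Fin (k + 1) → MvPolynomial (Fin (k + 1)) ℂ} {d e : ℕ} (hd : 0 < d)
    (hP : ∀ i, (P i).IsHomogeneous d) (he : 0 < e) (hQ : ∀ i, (Q i).IsHomogeneous e)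
    (hq : ∀ i, P i = q * Q i) {i : Fin (k + 1)} (hi : P i ∉ coneIdeal A)
    (g : MvPolynomial (Fin (k + 1)) ℂ) :
    bind₁ P g ∈ coneIdeal A ↔ bind₁ Q g ∈ coneIdeal A := by
  rw [← coneIdeal_diff_zeroSet hA hi, mem_coneIdeal, mem_coneIdeal]
  refine forall₂_congr fun x hx => ?_
  have hqx : eval x.coords q ≠ 0 := fun h =>
    hx.2 ((restrictLine_eq_zero_iff_of_isHomogeneous _ (hP i)).2 (by rw [hq, map_mul, h, zero_mul]))
  have eval_P : (fun i => eval x.coords (P i)) =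
      eval x.coords q • fun i => eval x.coords (Q i) := by
    funext i
    rw [hq, map_mul, Pi.smul_apply, smul_eq_mul]
  rw [restrictLine_bind₁_eq_zero_iff hd hP, restrictLine_bind₁_eq_zero_iff he hQ, eval_P,
    restrictLine_smul_eq_zero_iff hqx]

/-! ### Hypersurfaces of projective space -/

/- The Nullstellensatz in `ℂ^{k+1}` needs vanishing at the origin too, which represents no point of
`P^k`: multiplication by the variables provides it. -/
theorem dvd_mul_X_of_mem_coneIdeal_zeroSet {p g : MvPolynomial (Fin (k + 1)) ℂ} {d : ℕ}
    (hp : Prime p) (hd : p.IsHomogeneous d) (hg : g ∈ coneIdeal (zeroSet p)) (i : Fin (k + 1)) :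
    p ∣ g * X i := by
  have := (Ideal.span_singleton_prime hp.ne_zero).2 hp
  rw [← Ideal.mem_span_singleton,
    ← IsPrime.vanishingIdeal_zeroLocus (K := ℂ) (Ideal.span {p}), mem_vanishingIdeal_iff]
  intro v hv
  rw [aeval_eq_eval, map_mul, eval_X]
  obtain rfl | hv0 := eq_or_ne v 0
  · simp
  have hpv : eval v p = 0 := by
    simpa [aeval_eq_eval] using mem_zeroLocus_iff.1 hv p (Ideal.mem_span_singleton_self p)
  have hmem : mk v hv0 ∈ zeroSet p := (restrictLine_coords_mk_eq_zero_iff hv0 p).2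
    ((restrictLine_eq_zero_iff_of_isHomogeneous v hd).2 hpv)
  have hgv := (restrictLine_coords_mk_eq_zero_iff hv0 g).1 (mem_coneIdeal.1 hg _ hmem)
  rw [← one_smul ℂ v, ← eval_restrictLine, hgv, Polynomial.eval_zero, zero_mul]

theorem coneIdeal_zeroSet (hk : k ≠ 0) {p : MvPolynomial (Fin (k + 1)) ℂ} (hp : Irreducible p)
    {d : ℕ} (hd : p.IsHomogeneous d) : coneIdeal (zeroSet p) = Ideal.span {p} := by
  refine le_antisymm (fun g hg => Ideal.mem_span_singleton.2 ?_)
    ((Ideal.span_singleton_le_iff_mem _).2 (mem_coneIdeal_iff_subset_zeroSet.2 subset_rfl))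
  by_contra hpg
  have associated_X : ∀ i, Associated p (X i) := fun i =>
    hp.associated_of_dvd X_prime.irreducible
      ((hp.prime.dvd_or_dvd (dvd_mul_X_of_mem_coneIdeal_zeroSet hp.prime hd hg i)).resolve_left hpg)
  have X_dvd : (X 0 : MvPolynomial (Fin (k + 1)) ℂ) ∣ X (Fin.last k) :=
    ((associated_X 0).symm.trans (associated_X (Fin.last k))).dvd
  rw [X_dvd_X] at X_dvd
  exact hk (by simpa [Fin.ext_iff] using X_dvd.symm)

theorem isIrreducible_zeroSet (hk : k ≠ 0) {p : MvPolynomial (Fin (k + 1)) ℂ}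
    (hp : Irreducible p) {d : ℕ} (hd : p.IsHomogeneous d) : IsIrreducible (zeroSet p) :=
  isIrreducible_of_isPrime_coneIdeal <| by
    rw [coneIdeal_zeroSet hk hp hd]
    exact (Ideal.span_singleton_prime hp.ne_zero).2 hp.prime

theorem exists_irreducible_subset_zeroSet (hA : IsIrreducible A)
    {g : MvPolynomial (Fin (k + 1)) ℂ} {d : ℕ} (hd : g.IsHomogeneous d) (hg0 : g ≠ 0)
    (hg : g ∈ coneIdeal A) :
    ∃ p e, Irreducible p ∧ p.IsHomogeneous e ∧ A ⊆ zeroSet p := by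
  have := isPrime_coneIdeal hA
  obtain ⟨p, hp, ⟨c, rfl⟩, hpA⟩ := exists_irreducible_dvd_mem hg0 hg
  obtain ⟨e, -, he, -, -⟩ := DominatingMap.isHomogeneous_of_mul hg0 hd
  exact ⟨p, e, hp, he, mem_coneIdeal_iff_subset_zeroSet.1 hpA⟩

theorem codim_anti (h : A ⊆ B) : codim B ≤ codim A :=
  le_iInf₂ fun Z hZ => iInf₂_le Z (hZ.trans h)

theorem codim_eq_coheight (hA : IsIrreducible A) (hc : IsClosed A) :
    codim A = Order.coheight (⟨A, hA, hc⟩ : TopologicalSpace.IrreducibleCloseds (ProjSpace k)) :=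
  let Z : TopologicalSpace.IrreducibleCloseds (ProjSpace k) := ⟨A, hA, hc⟩
  le_antisymm (iInf₂_le Z (Set.Subset.refl A)) (le_iInf₂ fun _ hY => Order.coheight_anti hY)

theorem codim_eq_zero_iff (hA : IsIrreducible A) (hc : IsClosed A) :
    codim A = 0 ↔ A = Set.univ := by
  rw [codim_eq_coheight hA hc, Order.coheight_eq_zero]
  let P : TopologicalSpace.IrreducibleCloseds (ProjSpace k) :=
    ⟨Set.univ, isIrreducible_univ, isClosed_univ⟩
  refine ⟨fun h => Set.univ_subset_iff.1 (h (b := P) (Set.subset_univ A)), fun h Z _ => ?_⟩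
  exact (Set.subset_univ (Z : Set (ProjSpace k))).trans_eq h.symm

theorem codim_add_one_le (hA : IsIrreducible A) (hcA : IsClosed A) (hB : IsIrreducible B)
    (hcB : IsClosed B) (h : A ⊂ B) : codim B + 1 ≤ codim A := by
  rw [codim_eq_coheight hA hcA, codim_eq_coheight hB hcB]
  exact Order.coheight_add_one_le h

theorem eq_of_subset_of_codim_le (hA : IsIrreducible A) (hcA : IsClosed A)
    (hB : IsIrreducible B) (hcB : IsClosed B) (h : A ⊆ B) (hfin : codim B ≠ ⊤)
    (hle : codim A ≤ codim B) : A = B := by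
  by_contra hne
  have := (codim_add_one_le hA hcA hB hcB (h.ssubset_of_ne hne)).trans hle
  exact ((ENat.add_one_le_iff hfin).1 this).false

theorem codim_le_one_of_coneIdeal_eq_span (hA : IsIrreducible A) (hc : IsClosed A)
    {g : MvPolynomial (Fin (k + 1)) ℂ} (hg : Irreducible g)
    (hAg : coneIdeal A = Ideal.span {g}) : codim A ≤ 1 := by
  rw [codim_eq_coheight hA hc]
  refine Order.coheight_le_coe_iff.2 fun Y hAY => ?_
  have hlt : coneIdeal (Y : Set (ProjSpace k)) < Ideal.span {g} := by
    rw [← hAg]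
    exact lt_of_le_not_ge (coneIdeal_anti hAY.le)
      fun hle => hAY.not_ge ((coneIdeal_le_coneIdeal_iff hc).1 hle)
  have := isPrime_coneIdeal Y.isIrreducible
  have hY := (coneIdeal_eq_bot_iff Y.isClosed).1 (eq_bot_of_lt_span_singleton hg.not_isUnit hlt)
  rw [Nat.cast_one, Order.lt_one_iff]
  exact (codim_eq_coheight Y.isIrreducible Y.isClosed).symm.trans
    ((codim_eq_zero_iff Y.isIrreducible Y.isClosed).2 hY)

theorem codim_zeroSet (hk : k ≠ 0) {p : MvPolynomial (Fin (k + 1)) ℂ} (hp : Irreducible p)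
    {d : ℕ} (hd : p.IsHomogeneous d) : codim (zeroSet p) = 1 := by
  have hirr := isIrreducible_zeroSet hk hp hd
  have hcone := coneIdeal_zeroSet hk hp hd
  refine le_antisymm (codim_le_one_of_coneIdeal_eq_span hirr (isClosed_zeroSet p) hp hcone) ?_
  rw [Order.one_le_iff_ne_zero, Ne, codim_eq_zero_iff hirr (isClosed_zeroSet p),
    ← coneIdeal_eq_bot_iff (isClosed_zeroSet p), hcone, Ideal.span_singleton_eq_bot]
  exact hp.ne_zero

theorem exists_eq_zeroSet_of_codim_eq_one (hk : k ≠ 0) (hA : IsIrreducible A) (hc : IsClosed A)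
    (h : codim A = 1) : ∃ p d, Irreducible p ∧ p.IsHomogeneous d ∧ A = zeroSet p := by
  have hne : A ≠ Set.univ := fun hA' => by simp [(codim_eq_zero_iff hA hc).2 hA'] at h
  obtain ⟨x, hx⟩ := (Set.ne_univ_iff_exists_notMem A).1 hne
  obtain ⟨g, hg, ⟨d, hd⟩, hgx⟩ := exists_isHomogeneous_mem_coneIdeal hc hx
  have hg0 : g ≠ 0 := by
    rintro rfl
    exact hgx (map_zero _)
  obtain ⟨p, e, hp, he, hAp⟩ := exists_irreducible_subset_zeroSet hA hd hg0 hg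
  have hcodim := codim_zeroSet hk hp he
  exact ⟨p, e, hp, he, eq_of_subset_of_codim_le hA hc (isIrreducible_zeroSet hk hp he)
    (isClosed_zeroSet p) hAp (by simp [hcodim]) (h.trans hcodim.symm).le⟩

/-! ### Components -/

theorem isComponent_self (hA : IsIrreducible A) : IsComponent A A :=
  ⟨⟨hA, subset_rfl⟩, fun _ h _ => h.2⟩

theorem IsComponent.isClosed {Z : Set (ProjSpace k)} (hA : IsClosed A) (h : IsComponent Z A) :
    IsClosed Z :=
  isClosed_of_closure_subset
    (h.2 ⟨h.1.1.closure, closure_minimal h.1.2 hA⟩ subset_closure)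

theorem IsComponent.mem_of_sUnion {S : Set (Set (ProjSpace k))} (hS : S.Finite)
    (hirr : ∀ B ∈ S, IsIrreducible B) (hc : ∀ B ∈ S, IsClosed B) {Z : Set (ProjSpace k)}
    (h : IsComponent Z (⋃₀ S)) : Z ∈ S := by
  obtain ⟨B, hB, hZB⟩ := exists_subset_of_isIrreducible_of_subset_sUnion h.1.1 hS hc h.1.2
  rwa [hZB.antisymm (h.2 ⟨hirr B hB, Set.subset_sUnion_of_mem hB⟩ hZB)]

theorem exists_isComponent_subset {Y : Set (ProjSpace k)} (hY : IsIrreducible Y) (h : Y ⊆ A) :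
    ∃ Z, Y ⊆ Z ∧ IsComponent Z A :=
  exists_maximal_isIrreducible_subset hY h

theorem exists_isComponent_mem {x : ProjSpace k} (hx : x ∈ A) : ∃ Z, x ∈ Z ∧ IsComponent Z A := by
  simpa using exists_isComponent_subset isIrreducible_singleton (Set.singleton_subset_iff.2 hx)

theorem IsHypersurface.exists_isComponent (hA : IsHypersurface A) : ∃ Z, IsComponent Z A :=
  let ⟨_, hx⟩ := hA.2.1
  let ⟨Z, _, hZ⟩ := exists_isComponent_mem hx
  ⟨Z, hZ⟩

theorem IsHypersurface.codim_le_one (hA : IsHypersurface A) : codim A ≤ 1 := by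
  obtain ⟨Z, hZ⟩ := hA.exists_isComponent
  exact (codim_anti hZ.1.2).trans_eq (hA.2.2 Z hZ)

theorem isHypersurface_iff (hA : IsIrreducible A) (hc : IsClosed A) :
    IsHypersurface A ↔ codim A = 1 := by
  refine ⟨fun h => h.2.2 A (isComponent_self hA), fun h => ⟨hc, hA.nonempty, fun Z hZ => ?_⟩⟩
  rwa [hZ.1.2.antisymm (hZ.2 ⟨hA, subset_rfl⟩ hZ.1.2)]

theorem isHypersurface_sUnion {S : Set (Set (ProjSpace k))} (hS : S.Finite) (hne : S.Nonempty)
    (hirr : ∀ B ∈ S, IsIrreducible B) (hB : ∀ B ∈ S, IsHypersurface B) :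
    IsHypersurface (⋃₀ S) := by
  have hc : ∀ B ∈ S, IsClosed B := fun B h => (hB B h).1
  obtain ⟨B, hBS⟩ := hne
  refine ⟨Set.sUnion_eq_biUnion ▸ hS.isClosed_biUnion hc,
    (hB B hBS).2.1.mono (Set.subset_sUnion_of_mem hBS), fun Z hZ => ?_⟩
  have hZS := hZ.mem_of_sUnion hS hirr hc
  exact (isHypersurface_iff (hirr Z hZS) (hc Z hZS)).1 (hB Z hZS)

theorem one_lt_codim_iff :
    1 < codim A ↔ ∀ Z, IsIrreducible Z → IsClosed Z → Z ⊆ A → 1 < codim Z := by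
  refine ⟨fun h Z _ _ hZ => h.trans_le (codim_anti hZ), fun h => ?_⟩
  rw [← ENat.add_one_le_iff ENat.one_ne_top]
  refine le_iInf₂ fun Z hZ => ?_
  rw [ENat.add_one_le_iff ENat.one_ne_top]
  exact (h Z Z.isIrreducible Z.isClosed hZ).trans_eq
    (codim_eq_coheight Z.isIrreducible Z.isClosed)

theorem one_lt_codim_sUnion {S : Set (Set (ProjSpace k))} (hS : S.Finite)
    (hc : ∀ B ∈ S, IsClosed B) (h : ∀ B ∈ S, 1 < codim B) : 1 < codim (⋃₀ S) := by
  refine one_lt_codim_iff.2 fun Z hZ _ hZS => ?_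
  obtain ⟨B, hB, hZB⟩ := exists_subset_of_isIrreducible_of_subset_sUnion hZ hS hc hZS
  exact (h B hB).trans_le (codim_anti hZB)

end ProjSpace

/-! ### Images under dominating maps -/

namespace DominatingMap

open ProjSpace

variable {k : ℕ} {f : DominatingMap k} {A B : Set (ProjSpace k)}

theorem deg_pos (f : DominatingMap k) : 0 < f.deg := by
  refine Nat.pos_of_ne_zero fun h => f.dominating (Matrix.det_eq_zero_of_row_eq_zero 0 fun j => ?_)
  have hF := (totalDegree_zero_iff_isHomogeneous _).2 (h ▸ f.homogeneous 0)
  rw [polyJacobian, Matrix.of_apply, totalDegree_eq_zero_iff_eq_C.1 hF, pderiv_C]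

theorem mem_indet {x : ProjSpace k} : x ∈ f.indet ↔ ∀ i, x ∈ zeroSet (f.F i) := by
  simp [indet, ProjSpace.zeroLocus, zeroSet,
    fun i => restrictLine_eq_zero_iff_of_isHomogeneous x.coords (f.homogeneous i)]

theorem subset_indet_iff : A ⊆ f.indet ↔ ∀ i, f.F i ∈ coneIdeal A := by
  simp only [mem_coneIdeal_iff_subset_zeroSet, Set.subset_def, mem_indet]
  exact ⟨fun h i x hx => h x hx i, fun h x hx i => h i x hx⟩

theorem coneIdeal_diff_indet (hA : IsIrreducible A) (h : ¬ A ⊆ f.indet) :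
    coneIdeal (A \ f.indet) = coneIdeal A := by
  obtain ⟨i, hi⟩ := not_forall.1 (mt subset_indet_iff.2 h)
  have hsub : A \ zeroSet (f.F i) ⊆ A \ f.indet :=
    Set.sdiff_subset_sdiff_right fun x hx => mem_indet.1 hx i
  exact le_antisymm ((coneIdeal_anti hsub).trans_eq (coneIdeal_diff_zeroSet hA hi))
    (coneIdeal_anti Set.sdiff_subset)

theorem mem_coneIdeal_image (hA : IsIrreducible A) (h : ¬ A ⊆ f.indet)
    {g : MvPolynomial (Fin (k + 1)) ℂ} :
    g ∈ coneIdeal (f.image A) ↔ bind₁ f.F g ∈ coneIdeal A := by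
  have apply_iff : ∀ x hx, restrictLine (f.apply x hx).coords g = 0 ↔
      restrictLine x.coords (bind₁ f.F g) = 0 := fun x hx =>
    (restrictLine_coords_mk_eq_zero_iff _ g).trans
      (restrictLine_bind₁_eq_zero_iff f.deg_pos f.homogeneous g).symm
  rw [← coneIdeal_diff_indet hA h, image, coneIdeal_closure, mem_coneIdeal, mem_coneIdeal]
  refine ⟨fun hg x hx => (apply_iff x hx.2).1 (hg _ ⟨x, hx.2, hx.1, rfl⟩), ?_⟩
  rintro hg _ ⟨x, hxf, hxA, rfl⟩
  exact (apply_iff x hxf).2 (hg x ⟨hxA, hxf⟩)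

theorem isClosed_iterImage (n : ℕ) (hA : IsClosed A) : IsClosed (f.iterImage n A) := by
  cases n with
  | zero => exact hA
  | succ n => exact isClosed_closure

theorem image_mono (f : DominatingMap k) (h : A ⊆ B) : f.image A ⊆ f.image B :=
  closure_mono fun _ ⟨x, hx, hxA, hy⟩ => ⟨x, hx, h hxA, hy⟩

theorem iterImage_mono (n : ℕ) (h : A ⊆ B) : f.iterImage n A ⊆ f.iterImage n B := by
  cases n with
  | zero => exact h
  | succ n => exact image_mono _ h

theorem image_sUnion (f : DominatingMap k) {S : Set (Set (ProjSpace k))} (hS : S.Finite) :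
    f.image (⋃₀ S) = ⋃₀ (f.image '' S) := by
  rw [Set.sUnion_image]
  simp only [image]
  rw [← hS.closure_biUnion]
  congr 1
  ext y
  simp only [Set.mem_ofPred_eq, Set.mem_iUnion, Set.mem_sUnion]
  exact ⟨fun ⟨x, hx, ⟨A, hA, hxA⟩, h⟩ => ⟨A, hA, x, hx, hxA, h⟩,
    fun ⟨A, hA, x, hx, hxA, h⟩ => ⟨x, hx, ⟨A, hA, hxA⟩, h⟩⟩

theorem iterImage_sUnion (n : ℕ) {S : Set (Set (ProjSpace k))} (hS : S.Finite) :
    f.iterImage n (⋃₀ S) = ⋃₀ (f.iterImage n '' S) := by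
  cases n with
  | zero => exact (congrArg Set.sUnion (Set.image_id S)).symm
  | succ n => exact image_sUnion _ hS

/-- The pull-back of polynomials by the `n`-fold composition of the lifting `F` with itself, from
which, unlike in the lifting of `f^n`, common factors are not removed. -/
noncomputable def pull (f : DominatingMap k) (n : ℕ) :
    MvPolynomial (Fin (k + 1)) ℂ →ₐ[ℂ] MvPolynomial (Fin (k + 1)) ℂ :=
  bind₁ f.F ^ n

theorem pull_add (f : DominatingMap k) (m n : ℕ) (g : MvPolynomial (Fin (k + 1)) ℂ) :
    f.pull (m + n) g = f.pull m (f.pull n g) := by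
  rw [pull, pow_add]
  rfl

theorem pull_one (f : DominatingMap k) : f.pull 1 = bind₁ f.F := pow_one _

theorem pull_zero_apply (f : DominatingMap k) (g : MvPolynomial (Fin (k + 1)) ℂ) :
    f.pull 0 g = g := rfl

theorem pull_succ (f : DominatingMap k) (n : ℕ) (g : MvPolynomial (Fin (k + 1)) ℂ) :
    f.pull (n + 1) g = bind₁ f.F (f.pull n g) := by
  rw [add_comm n 1, pull_add, pull_one]

theorem bind₁_pull_X (f : DominatingMap k) (n : ℕ) :
    bind₁ (fun i => f.pull n (X i)) = f.pull n :=
  algHom_ext fun i => bind₁_X_right _ i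

theorem isHomogeneous_pull_X (f : DominatingMap k) (n : ℕ) (i : Fin (k + 1)) :
    (f.pull n (X i)).IsHomogeneous (f.deg ^ n) := by
  induction n with
  | zero => exact isHomogeneous_X ℂ i
  | succ n ih =>
    rw [pull_succ, pow_succ']
    exact ih.aeval _ f.homogeneous

theorem pull_ne_zero (n : ℕ) {g : MvPolynomial (Fin (k + 1)) ℂ} (hg : g ≠ 0) :
    f.pull n g ≠ 0 := by
  induction n with
  | zero => exact hg
  | succ n ih =>
    rw [pull_succ]
    exact bind₁_ne_zero f.dominating ih

theorem exists_pull_X_eq_mul (f : DominatingMap k) (n : ℕ) :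
    ∃ q, ∀ i, f.pull (n + 1) (X i) = q * (f.iterateSucc n).F i := by
  induction n with
  | zero => exact ⟨1, fun i => by rw [zero_add, pull_one, bind₁_X_right, one_mul]; rfl⟩
  | succ n ih =>
    obtain ⟨q, hq⟩ := ih
    obtain ⟨r, -, hr⟩ := (f.iterateSucc n).comp_spec f
    refine ⟨bind₁ f.F q * r, fun i => ?_⟩
    rw [pull_succ, hq, map_mul, hr, mul_assoc]
    rfl

/-- The `n`-fold composition of the lifting of `f` with itself does not vanish identically on `A`.
For irreducible `A` this says that none of the images of `A` before time `n` lies in `I(f)`. -/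
def LiftNonzeroOn (f : DominatingMap k) (n : ℕ) (A : Set (ProjSpace k)) : Prop :=
  ∃ i, f.pull n (X i) ∉ coneIdeal A

theorem mem_coneIdeal_iterImage (hA : IsIrreducible A) {n : ℕ} (h : f.LiftNonzeroOn n A)
    {g : MvPolynomial (Fin (k + 1)) ℂ} :
    g ∈ coneIdeal (f.iterImage n A) ↔ f.pull n g ∈ coneIdeal A := by
  cases n with
  | zero => rfl
  | succ n =>
    obtain ⟨i, hi⟩ := h
    obtain ⟨q, hq⟩ := f.exists_pull_X_eq_mul n
    have hsub : ¬ A ⊆ (f.iterateSucc n).indet := fun hsub =>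
      hi (hq i ▸ Ideal.mul_mem_left _ q (subset_indet_iff.1 hsub i))
    rw [iterImage, mem_coneIdeal_image hA hsub, ← bind₁_pull_X f (n + 1)]
    exact (bind₁_mem_coneIdeal_iff_of_eq_mul hA (pow_pos f.deg_pos _)
      (f.isHomogeneous_pull_X (n + 1)) (deg_pos _) (f.iterateSucc n).homogeneous hq hi g).symm

theorem isIrreducible_iterImage (hA : IsIrreducible A) {n : ℕ} (h : f.LiftNonzeroOn n A) :
    IsIrreducible (f.iterImage n A) := by
  have := isPrime_coneIdeal hA
  refine isIrreducible_of_isPrime_coneIdeal ?_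
  rw [show coneIdeal (f.iterImage n A) = (coneIdeal A).comap (f.pull n) from
    Ideal.ext fun g => mem_coneIdeal_iterImage hA h]
  exact Ideal.comap_isPrime _ _

theorem liftNonzeroOn_zero (hA : A.Nonempty) : f.LiftNonzeroOn 0 A := by
  obtain ⟨x, hx⟩ := hA
  obtain ⟨i, hi⟩ := Function.ne_iff.1 x.coords_ne_zero
  refine ⟨i, fun h => hi ?_⟩
  simpa [pull_zero_apply, restrictLine_X] using mem_coneIdeal.1 h x hx

theorem liftNonzeroOn_one_iff : f.LiftNonzeroOn 1 A ↔ ¬ A ⊆ f.indet := by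
  simp [LiftNonzeroOn, subset_indet_iff, pull_one]

theorem liftNonzeroOn_add_iff (hA : IsIrreducible A) {m n : ℕ} (hm : f.LiftNonzeroOn m A) :
    f.LiftNonzeroOn (m + n) A ↔ f.LiftNonzeroOn n (f.iterImage m A) :=
  exists_congr fun i => not_congr (by rw [mem_coneIdeal_iterImage hA hm, pull_add])

theorem liftNonzeroOn_of_forall_lt (hA : IsIrreducible A) {n : ℕ}
    (h : ∀ m < n, ¬ f.iterImage m A ⊆ f.indet) : f.LiftNonzeroOn n A := by
  induction n with
  | zero => exact liftNonzeroOn_zero hA.nonempty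
  | succ n ih =>
    have hn := ih fun m hm => h m (hm.trans n.lt_succ_self)
    exact (liftNonzeroOn_add_iff hA hn).2 (liftNonzeroOn_one_iff.2 (h n n.lt_succ_self))

theorem iterImage_iterImage (hA : IsIrreducible A) (hc : IsClosed A) {m n : ℕ}
    (hm : f.LiftNonzeroOn m A) (h : f.LiftNonzeroOn (m + n) A) :
    f.iterImage n (f.iterImage m A) = f.iterImage (m + n) A := by
  rw [← coneIdeal_inj (isClosed_iterImage n (isClosed_iterImage m hc)) (isClosed_iterImage _ hc)]
  ext g
  rw [mem_coneIdeal_iterImage (isIrreducible_iterImage hA hm) ((liftNonzeroOn_add_iff hA hm).1 h),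
    mem_coneIdeal_iterImage hA hm, mem_coneIdeal_iterImage hA h, pull_add]

theorem iterImage_univ (f : DominatingMap k) (n : ℕ) : f.iterImage n Set.univ = Set.univ := by
  have h : f.LiftNonzeroOn n Set.univ := ⟨0, by
    rw [coneIdeal_univ, Submodule.mem_bot]
    exact pull_ne_zero n (X_ne_zero 0)⟩
  rw [← coneIdeal_eq_bot_iff (isClosed_iterImage n isClosed_univ), eq_bot_iff]
  intro g hg
  rw [mem_coneIdeal_iterImage isIrreducible_univ h, coneIdeal_univ, Submodule.mem_bot] at hg
  exact (Submodule.mem_bot _).2 (not_imp_not.1 (pull_ne_zero n) hg)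

theorem exists_F_ne_zero (f : DominatingMap k) : ∃ i, f.F i ≠ 0 := by
  by_contra! h
  exact not_isUnit_zero (f.coprime 0 fun i => by rw [h i])

/-! ### Codimension of the indeterminacy locus and of images of hypersurfaces -/

theorem one_lt_codim_of_subset_indet (hA : A ⊆ f.indet) : 1 < codim A := by
  refine one_lt_codim_iff.2 fun Z hZ hcZ hZA => ?_
  have F_mem := subset_indet_iff.1 (hZA.trans hA)
  obtain ⟨i, hi⟩ := f.exists_F_ne_zero
  obtain ⟨p, e, hp, he, hZp⟩ := exists_irreducible_subset_zeroSet hZ (f.homogeneous i) hi (F_mem i)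
  have hne : Z ≠ zeroSet p := by
    rintro rfl
    rw [coneIdeal_zeroSet f.k_ne_zero hp he] at F_mem
    exact hp.not_isUnit (f.coprime p fun j => Ideal.mem_span_singleton.1 (F_mem j))
  have hlt := codim_add_one_le hZ hcZ (isIrreducible_zeroSet f.k_ne_zero hp he)
    (isClosed_zeroSet p) (hZp.ssubset_of_ne hne)
  rw [codim_zeroSet f.k_ne_zero hp he] at hlt
  exact (ENat.add_one_le_iff ENat.one_ne_top).1 hlt

theorem not_subset_indet_of_codim_eq_one (h : codim A = 1) : ¬ A ⊆ f.indet := fun hsub =>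
  (one_lt_codim_of_subset_indet hsub).ne' h

/- Where `det J ≠ 0`, the gradients of two polynomials vanishing on the image of `{p = 0}` are both
pulled back to multiples of the gradient of `p`. Hence they are parallel along the image, which
therefore has a principal ideal. -/
theorem dvd_det_polyJacobian_of_one_lt_codim_image {p : MvPolynomial (Fin (k + 1)) ℂ}
    (hp : Irreducible p) {d : ℕ} (hd : p.IsHomogeneous d) (h : 1 < codim (f.image (zeroSet p))) :
    p ∣ (polyJacobian f.F).det := by
  by_contra hJ
  have hk := f.k_ne_zero
  have hirr := isIrreducible_zeroSet hk hp hd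
  have hsub := not_subset_indet_of_codim_eq_one (f := f) (codim_zeroSet hk hp hd)
  have hirr' : IsIrreducible (f.image (zeroSet p)) :=
    isIrreducible_iterImage (n := 1) hirr (liftNonzeroOn_one_iff.2 hsub)
  have hc' : IsClosed (f.image (zeroSet p)) := isClosed_closure
  have hne : coneIdeal (f.image (zeroSet p)) ≠ ⊥ := by
    rw [Ne, coneIdeal_eq_bot_iff hc', ← codim_eq_zero_iff hirr' hc']
    exact (zero_lt_one.trans h).ne'
  have mem_iff : ∀ g, g ∈ coneIdeal (f.image (zeroSet p)) ↔ p ∣ bind₁ f.F g := fun g => by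
    rw [mem_coneIdeal_image hirr hsub, coneIdeal_zeroSet hk hp hd, Ideal.mem_span_singleton]
  have := isPrime_coneIdeal hirr'
  obtain ⟨g, hg, hspan⟩ := eq_span_singleton_of_pderiv_minors_mem hne fun g hg w hw i j =>
    (mem_iff _).2 (dvd_bind₁_pderiv_minor hp.prime hJ ((mem_iff g).1 hg) ((mem_iff w).1 hw) i j)
  exact h.not_ge (codim_le_one_of_coneIdeal_eq_span hirr' hc' hg hspan)

/-! ### Heights -/

theorem HasHeight.unique {m n : ℕ} (hm : f.HasHeight A m) (hn : f.HasHeight A n) : m = n :=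
  IsLeast.unique hm hn

theorem exists_hasHeight {m : ℕ} (hm : 1 ≤ m) (h : f.iterImage m A ⊆ f.indet) :
    ∃ n, f.HasHeight A n :=
  ⟨_, isLeast_csInf ⟨m, hm, h⟩⟩

theorem hasHeight_sUnion {S : Set (Set (ProjSpace k))} (hS : S.Finite) (hne : S.Nonempty) {n : ℕ}
    (h : ∀ B ∈ S, f.HasHeight B n) : f.HasHeight (⋃₀ S) n := by
  have subset_iff : ∀ m, f.iterImage m (⋃₀ S) ⊆ f.indet ↔ ∀ B ∈ S, f.iterImage m B ⊆ f.indet :=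
    fun m => by rw [iterImage_sUnion m hS, Set.sUnion_subset_iff, Set.forall_mem_image]
  obtain ⟨B, hB⟩ := hne
  exact ⟨⟨(h B hB).1.1, (subset_iff n).2 fun B hB => (h B hB).1.2⟩,
    fun m hm => (h B hB).2 ⟨hm.1, (subset_iff m).1 hm.2 B hB⟩⟩

namespace HasHeight

variable {m n : ℕ}

theorem liftNonzeroOn (h : f.HasHeight A n) (hA : IsIrreducible A) (hcodim : codim A = 1)
    (hm : m ≤ n) : f.LiftNonzeroOn m A := by
  refine liftNonzeroOn_of_forall_lt hA fun l hl hsub => ?_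
  obtain rfl | hpos := l.eq_zero_or_pos
  · exact not_subset_indet_of_codim_eq_one hcodim hsub
  · exact (h.2 ⟨hpos, hsub⟩).not_gt (hl.trans_le hm)

theorem iterImage_iterImage (h : f.HasHeight A n) (hA : IsIrreducible A) (hc : IsClosed A)
    (hcodim : codim A = 1) {l : ℕ} (hml : m + l ≤ n) :
    f.iterImage l (f.iterImage m A) = f.iterImage (m + l) A :=
  DominatingMap.iterImage_iterImage hA hc
    (h.liftNonzeroOn hA hcodim ((Nat.le_add_right m l).trans hml)) (h.liftNonzeroOn hA hcodim hml)

theorem hasHeight_iterImage (h : f.HasHeight A n) (hA : IsIrreducible A) (hc : IsClosed A)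
    (hcodim : codim A = 1) (hm : m < n) : f.HasHeight (f.iterImage m A) (n - m) := by
  refine ⟨⟨Nat.sub_pos_of_lt hm, ?_⟩, fun l hl => ?_⟩
  · rw [h.iterImage_iterImage hA hc hcodim (Nat.add_sub_cancel' hm.le).le,
      Nat.add_sub_cancel' hm.le]
    exact h.1.2
  · by_contra! hlt
    have hle : m + l ≤ n := by lia
    have hsub := h.iterImage_iterImage hA hc hcodim hle ▸ hl.2
    have := h.2 ⟨Nat.le_add_left_of_le hl.1, hsub⟩
    lia

theorem codim_iterImage_ne_zero (h : f.HasHeight A n) (hA : IsIrreducible A) (hc : IsClosed A)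
    (hcodim : codim A = 1) (hm : m ≤ n) : codim (f.iterImage m A) ≠ 0 := by
  have hirr := isIrreducible_iterImage hA (h.liftNonzeroOn hA hcodim hm)
  rw [Ne, codim_eq_zero_iff hirr (isClosed_iterImage m hc)]
  intro huniv
  have hn := h.iterImage_iterImage hA hc hcodim (Nat.add_sub_cancel' hm).le
  rw [huniv, iterImage_univ, Nat.add_sub_cancel' hm] at hn
  have hlt := one_lt_codim_of_subset_indet (hn ▸ h.1.2)
  rw [(codim_eq_zero_iff isIrreducible_univ isClosed_univ).2 rfl] at hlt
  exact hlt.not_ge zero_le_one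

end HasHeight

end DominatingMap

/-! ### Primitive degree lowering hypersurfaces -/

namespace DominatingMap

open ProjSpace

variable {k : ℕ}

/-- `Z` is a primitive degree lowering hypersurface of height `n`: it is irreducible, and none of
its images up to the time `n` at which it is sent into `I(f)` is a hypersurface again. These are
the irreducible components of the hypersurfaces in the theorem. -/
structure IsPrimitive (f : DominatingMap k) (n : ℕ) (Z : Set (ProjSpace k)) : Prop where
  isIrreducible : IsIrreducible Z
  isClosed : IsClosed Z
  codim_eq_one : codim Z = 1
  hasHeight : f.HasHeight Z n
  one_lt_codim_iterImage : ∀ m, 1 ≤ m → m ≤ n → 1 < codim (f.iterImage m Z)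

theorem IsPrimitive.isHypersurface {f : DominatingMap k} {n : ℕ} {Z : Set (ProjSpace k)}
    (h : f.IsPrimitive n Z) : IsHypersurface Z :=
  (isHypersurface_iff h.isIrreducible h.isClosed).2 h.codim_eq_one

/-- The union of the primitive degree lowering hypersurfaces of height `n`. -/
def primitiveUnion (f : DominatingMap k) (n : ℕ) : Set (ProjSpace k) :=
  ⋃₀ {Z | f.IsPrimitive n Z}

/-- The heights of the primitive degree lowering hypersurfaces. -/
def primitiveHeights (f : DominatingMap k) : Set ℕ := {n | ∃ Z, f.IsPrimitive n Z}

variable {f : DominatingMap k} {n : ℕ}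

theorem exists_zeroSet_eq_of_isPrimitive {Z : Set (ProjSpace k)} (hZ : f.IsPrimitive n Z) :
    ∃ p, Irreducible p ∧ p ∣ (polyJacobian f.F).det ∧ zeroSet p = Z := by
  obtain ⟨p, d, hp, hd, rfl⟩ :=
    exists_eq_zeroSet_of_codim_eq_one f.k_ne_zero hZ.isIrreducible hZ.isClosed hZ.codim_eq_one
  exact ⟨p, hp, dvd_det_polyJacobian_of_one_lt_codim_image hp hd
    (hZ.one_lt_codim_iterImage 1 le_rfl hZ.hasHeight.1.1), rfl⟩

theorem finite_setOf_exists_isPrimitive (f : DominatingMap k) :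
    {Z | ∃ n, f.IsPrimitive n Z}.Finite := by
  classical
  refine ((UniqueFactorizationMonoid.factors (polyJacobian f.F).det).toFinset.finite_toSet.image
    zeroSet).subset ?_
  rintro Z ⟨n, hZ⟩
  obtain ⟨p, hp, hdvd, rfl⟩ := exists_zeroSet_eq_of_isPrimitive hZ
  obtain ⟨q, hq, hpq⟩ := UniqueFactorizationMonoid.exists_mem_factors_of_dvd f.dominating hp hdvd
  exact ⟨q, Multiset.mem_toFinset.2 hq, zeroSet_eq_of_associated hpq.symm⟩

theorem finite_setOf_isPrimitive (f : DominatingMap k) (n : ℕ) : {Z | f.IsPrimitive n Z}.Finite :=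
  f.finite_setOf_exists_isPrimitive.subset fun _ hZ => ⟨n, hZ⟩

theorem finite_primitiveHeights (f : DominatingMap k) : f.primitiveHeights.Finite := by
  choose! height hasHeight using fun Z (hZ : Z ∈ {Z | ∃ n, f.IsPrimitive n Z}) => hZ
  refine (f.finite_setOf_exists_isPrimitive.image height).subset ?_
  rintro n ⟨Z, hZ⟩
  exact ⟨Z, ⟨n, hZ⟩, (hasHeight Z ⟨n, hZ⟩).hasHeight.unique hZ.hasHeight⟩

theorem isPrimitive_of_isComponent_primitiveUnion {Z : Set (ProjSpace k)}
    (h : IsComponent Z (f.primitiveUnion n)) : f.IsPrimitive n Z :=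
  h.mem_of_sUnion (f.finite_setOf_isPrimitive n) (fun _ hB => hB.isIrreducible)
    fun _ hB => hB.isClosed

theorem isDegreeLowering_primitiveUnion (hn : n ∈ f.primitiveHeights) :
    f.IsDegreeLowering (f.primitiveUnion n) n :=
  ⟨isHypersurface_sUnion (f.finite_setOf_isPrimitive n) hn (fun _ hB => hB.isIrreducible)
      fun _ hB => hB.isHypersurface,
    hasHeight_sUnion (f.finite_setOf_isPrimitive n) hn fun _ hB => hB.hasHeight⟩

theorem one_lt_codim_iterImage_primitiveUnion {m : ℕ} (hm : 1 ≤ m) (hmn : m ≤ n) :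
    1 < codim (f.iterImage m (f.primitiveUnion n)) := by
  have hfin := f.finite_setOf_isPrimitive n
  rw [primitiveUnion, iterImage_sUnion m hfin]
  exact one_lt_codim_sUnion (hfin.image _)
    (Set.forall_mem_image.2 fun _ hB => isClosed_iterImage m hB.isClosed)
    (Set.forall_mem_image.2 fun _ hB => hB.one_lt_codim_iterImage m hm hmn)

theorem exists_isPrimitive_iterImage {A : Set (ProjSpace k)} (hA : IsIrreducible A)
    (h : f.IsDegreeLowering A n) : ∃ m < n, f.IsPrimitive (n - m) (f.iterImage m A) := by
  classical
  obtain ⟨hyp, height⟩ := h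
  have hc := hyp.1
  have hcodim := (isHypersurface_iff hA hc).1 hyp
  have hn := height.1.1
  -- the last image of codimension one
  let m := Nat.findGreatest (fun m => codim (f.iterImage m A) = 1) (n - 1)
  have hm : codim (f.iterImage m A) = 1 :=
    Nat.findGreatest_spec (P := fun m => codim (f.iterImage m A) = 1) (Nat.zero_le _) hcodim
  have hmn : m < n := (Nat.findGreatest_le _).trans_lt (Nat.sub_one_lt_of_lt hn)
  have one_lt_codim : ∀ l, m < l → l ≤ n → 1 < codim (f.iterImage l A) := by
    intro l hml hln
    obtain hlt | rfl := hln.lt_or_eq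
    · exact lt_of_le_of_ne
        (Order.one_le_iff_ne_zero.2 (height.codim_iterImage_ne_zero hA hc hcodim hln))
        (Ne.symm (Nat.findGreatest_is_greatest hml (Nat.le_sub_one_of_lt hlt)))
    · exact one_lt_codim_of_subset_indet height.1.2
  refine ⟨m, hmn, isIrreducible_iterImage hA (height.liftNonzeroOn hA hcodim hmn.le),
    isClosed_iterImage m hc, hm, height.hasHeight_iterImage hA hc hcodim hmn, fun l hl hln => ?_⟩
  have hmln : m + l ≤ n := by lia
  rw [height.iterImage_iterImage hA hc hcodim hmln]
  exact one_lt_codim _ (Nat.lt_add_of_pos_right hl) hmln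

theorem isPrimitiveFamily_primitiveUnion {M : ℕ} {n : Fin M → ℕ} (hn : Function.Injective n)
    (hrange : Set.range n = f.primitiveHeights) :
    f.IsPrimitiveFamily M (fun j => f.primitiveUnion (n j)) n where
  degreeLowering j := isDegreeLowering_primitiveUnion (hrange ▸ Set.mem_range_self j)
  component _ _ hZ := (isPrimitive_of_isComponent_primitiveUnion hZ).hasHeight
  injective := hn
  codim _ _ hm hmn := one_lt_codim_iterImage_primitiveUnion hm hmn
  lands A h hA hdl := by
    obtain ⟨m, hmh, hm⟩ := exists_isPrimitive_iterImage hA hdl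
    obtain ⟨j, hj⟩ : h - m ∈ Set.range n := hrange ▸ ⟨_, hm⟩
    exact ⟨m, hmh, j, hm.isHypersurface, Set.subset_sUnion_of_mem (by rwa [hj])⟩

namespace IsPrimitiveFamily

variable {M : ℕ} {H : Fin M → Set (ProjSpace k)} {n : Fin M → ℕ}

theorem isPrimitive_of_isComponent (h : f.IsPrimitiveFamily M H n) {j : Fin M}
    {Z : Set (ProjSpace k)} (hZ : IsComponent Z (H j)) : f.IsPrimitive (n j) Z where
  isIrreducible := hZ.1.1
  isClosed := hZ.isClosed (h.degreeLowering j).1.1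
  codim_eq_one := (h.degreeLowering j).1.2.2 Z hZ
  hasHeight := h.component j Z hZ
  one_lt_codim_iterImage m hm hmn :=
    (h.codim j m hm hmn).trans_le (codim_anti (iterImage_mono m hZ.1.2))

theorem exists_isComponent_of_isPrimitive (h : f.IsPrimitiveFamily M H n) {l : ℕ}
    {Z : Set (ProjSpace k)} (hZ : f.IsPrimitive l Z) : ∃ j, n j = l ∧ IsComponent Z (H j) := by
  obtain ⟨m, hml, j, hyp, hsub⟩ := h.lands Z l hZ.isIrreducible ⟨hZ.isHypersurface, hZ.hasHeight⟩
  obtain rfl : m = 0 := by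
    by_contra hm
    exact (hZ.one_lt_codim_iterImage m (Nat.one_le_iff_ne_zero.2 hm) hml.le).not_ge
      hyp.codim_le_one
  obtain ⟨Y, hZY, hY⟩ := exists_isComponent_subset hZ.isIrreducible hsub
  have hYp := h.isPrimitive_of_isComponent hY
  obtain rfl := eq_of_subset_of_codim_le hZ.isIrreducible hZ.isClosed hYp.isIrreducible
    hYp.isClosed hZY (by simp [hYp.codim_eq_one]) (hZ.codim_eq_one.trans hYp.codim_eq_one.symm).le
  exact ⟨j, hYp.hasHeight.unique hZ.hasHeight, hY⟩

theorem eq_primitiveUnion (h : f.IsPrimitiveFamily M H n) (j : Fin M) :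
    H j = f.primitiveUnion (n j) := by
  refine Set.Subset.antisymm (fun x hx => ?_) (Set.sUnion_subset fun Z hZ => ?_)
  · obtain ⟨Z, hxZ, hZ⟩ := exists_isComponent_mem hx
    exact ⟨Z, h.isPrimitive_of_isComponent hZ, hxZ⟩
  · obtain ⟨i, hi, hZi⟩ := h.exists_isComponent_of_isPrimitive hZ
    obtain rfl := h.injective hi
    exact hZi.1.2

theorem range_eq_primitiveHeights (h : f.IsPrimitiveFamily M H n) :
    Set.range n = f.primitiveHeights := by
  refine Set.Subset.antisymm ?_ fun l ⟨Z, hZ⟩ => ?_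
  · rintro _ ⟨j, rfl⟩
    obtain ⟨Z, hZ⟩ := (h.degreeLowering j).1.exists_isComponent
    exact ⟨Z, h.isPrimitive_of_isComponent hZ⟩
  · obtain ⟨j, hj, -⟩ := h.exists_isComponent_of_isPrimitive hZ
    exact ⟨j, hj⟩

theorem unique (h : f.IsPrimitiveFamily M H n) {M' : ℕ} {H' : Fin M' → Set (ProjSpace k)}
    {n' : Fin M' → ℕ} (h' : f.IsPrimitiveFamily M' H' n') :
    M' = M ∧ ∃ e : Fin M' ≃ Fin M, ∀ j, H' j = H (e j) ∧ n' j = n (e j) := by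
  have range_eq : Set.range n' = Set.range n :=
    h'.range_eq_primitiveHeights.trans h.range_eq_primitiveHeights.symm
  let e : Fin M' ≃ Fin M := (Equiv.ofInjective n' h'.injective).trans
    ((Equiv.setCongr range_eq).trans (Equiv.ofInjective n h.injective).symm)
  have height_eq : ∀ j, n' j = n (e j) := fun j =>
    (Equiv.apply_ofInjective_symm h.injective ⟨n' j, range_eq ▸ Set.mem_range_self j⟩).symm
  refine ⟨Fin.equiv_iff_eq.1 ⟨e⟩, e, fun j => ⟨?_, height_eq j⟩⟩
  rw [h'.eq_primitiveUnion, h.eq_primitiveUnion, height_eq]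

theorem isAlgebraicallyStable_iff (h : f.IsPrimitiveFamily M H n) :
    f.IsAlgebraicallyStable ↔ M = 0 := by
  constructor
  · intro hstable
    by_contra hM
    have hdl := h.degreeLowering ⟨0, Nat.pos_of_ne_zero hM⟩
    exact hstable ⟨_, _, hdl.1, hdl.2.1⟩
  · rintro rfl ⟨A, N, hA, hN, hsub⟩
    obtain ⟨Z, hZ⟩ := hA.exists_isComponent
    obtain ⟨m, hm⟩ := exists_hasHeight hN ((iterImage_mono N hZ.1.2).trans hsub)
    have hyp := (isHypersurface_iff hZ.1.1 (hZ.isClosed hA.1)).2 (hA.2.2 Z hZ)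
    obtain ⟨-, -, j, -⟩ := h.lands Z m hZ.1.1 ⟨hyp, hm⟩
    exact j.elim0

end IsPrimitiveFamily

end DominatingMap

theorem mainTheorem3 (k : ℕ) (hk : 2 ≤ k) (f : DominatingMap k) :
    ∃ (M : ℕ) (H : Fin M → Set (ProjSpace k)) (n : Fin M → ℕ),
      f.IsPrimitiveFamily M H n ∧
      (∀ (M' : ℕ) (H' : Fin M' → Set (ProjSpace k)) (n' : Fin M' → ℕ),
        f.IsPrimitiveFamily M' H' n' →
          M' = M ∧ ∃ e : Fin M' ≃ Fin M, ∀ j, H' j = H (e j) ∧ n' j = n (e j)) ∧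
      (f.IsAlgebraicallyStable ↔ M = 0) := by
  let s := f.finite_primitiveHeights.toFinset
  let n := s.orderEmbOfFin rfl
  have range_eq : Set.range n = f.primitiveHeights := by
    rw [Finset.range_orderEmbOfFin, Set.Finite.coe_toFinset]
  have h := DominatingMap.isPrimitiveFamily_primitiveUnion n.injective range_eq
  exact ⟨_, _, n, h, fun _ _ _ h' => h.unique h', h.isAlgebraicallyStable_iff⟩
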